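/- **Conventions.** $M_k$ is the C*-algebra of complex $k\times k$ matrices, $D^n$ is the closed unit ball of $\mathbb R^n$ and $S^{n-1}$ its boundary sphere ($S^{-1}=\emptyset$). The class of noncommutative cell complexes (NCCCs) is the smallest class of C*-algebras that contains all finite-dimensional C*-algebras and contains, with $B$, every pullback $$A=B\oplus_{M_k(C(S^{n-1}))}M_k(C(D^n))=\{(b,g)\in B\oplus M_k(C(D^n)):\varphi(b)=g|_{S^{n-1}}\},$$ where $n\ge 0$, $k\ge 1$ and $\varphi:B\to M_k(C(S^{n-1}))$ is a unital homomorphism (homomorphism means $*$-homomorphism). For a unital C*-algebra $A$ let $\mathrm T(A)$ be the set of its tracial states and, for $a=a^*\in A$, let $\hat a:\mathrm T(A)\to\mathbb R$, $\hat a(\tau)=\tau(a)$. Let $A^+_{1,q}=\{\hat h: h\in A,\ h\ge 0,\ \|h\|\le 1\}$, ordered pointwise on $\mathrm T(A)$. Let $\mathrm{tr}$ be the normalized trace of $M_m$. **Theorem.** Let $A=B\oplus_{M_k(C(S^{n-1}))}M_k(C(D^n))$ be as above with $B$ an NCCC, and assume that $A$ is infinite dimensional (this is automatic if $n\ge1$).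 Let $\Delta:A^+_{1,q}\setminus\{0\}\to(0,1)$ be an order preserving map, let $\mathcal F\subseteq A$ be a finite set, and let $\varepsilon>0$, $\eta>0$ and $K\in\mathbb N\setminus\{0\}$. Then there are a finite set $\mathcal H_1$ of positive elements $h\in A$ with $\|h\|\le1$ and $\hat h\ne0$, a finite set $\mathcal H_2$ of positive elements of $A$, and $\delta>0$, such that the following holds for every $m$ and all unital homomorphisms $\phi,\psi:A\to M_m$. If 1. $\mathrm{tr}(\phi(h))>\Delta(\hat h)$ and $\mathrm{tr}(\psi(h))>\Delta(\hat h)$ for all $h\in\mathcal H_1$, and 2. $|\mathrm{tr}(\phi(h))-\mathrm{tr}(\psi(h))|<\delta$ for all $h\in\mathcal H_2$, then there are unital homomorphisms $\tilde\phi,\tilde\psi:A\to M_m$ such that 3. $\|\tilde\phi(f)-\phi(f)\|<\varepsilon$ and $\|\tilde\psi(f)-\psi(f)\|<\varepsilon$ for all $f\in\mathcal F$, and 4. $\tilde\phi$ and $\tilde\psi$ have decompositions $$\tilde\phi=\tilde\phi_0\oplus\underbrace{\tilde\phi_1\oplus\cdots\oplus\tilde\phi_1}_K,\qquad \tilde\psi=\tilde\psi_0\oplus\underbrace{\tilde\psi_1\oplus\cdots\oplus\tilde\psi_1}_K$$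 (with respect to decompositions $\mathbb C^m\cong\mathbb C^{m_0}\oplus(\mathbb C^{m_1})^{K}$ given by unitaries that may differ for $\tilde\phi$ and $\tilde\psi$), where $\tilde\phi_1,\tilde\psi_1:A\to M_{m_1}$ are unitarily equivalent and, for every positive $a\in\mathcal F$, $$\mathrm{tr}(\tilde\phi_0(a))\le\eta\cdot\mathrm{tr}(\tilde\phi(a)),\qquad \mathrm{tr}(\tilde\psi_0(a))\le\eta\cdot\mathrm{tr}(\tilde\psi(a)).$$ Here $\tilde\phi_0(a)$ and $\tilde\psi_0(a)$ are regarded as elements of $M_m$, so that $\mathrm{tr}$ is $\frac1m$ times the sum of the diagonal entries. -/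

import Mathlib

open scoped Matrix.Norms.L2Operator ComplexOrder

universe u

/-- The closed unit ball `D^n` of `ℝ^n`. -/
abbrev Disk (n : ℕ) : Type := Metric.closedBall (0 : EuclideanSpace ℝ (Fin n)) 1

/-- The unit sphere `S^{n-1}` of `ℝ^n`; it is empty for `n = 0`. -/
abbrev DiskBoundary (n : ℕ) : Type := Metric.sphere (0 : EuclideanSpace ℝ (Fin n)) 1

/-- The C*-algebra `M_k` of complex `k × k` matrices, with the operator norm. -/
abbrev Mat (k : ℕ) : Type := Matrix (Fin k) (Fin k) ℂ

/-- The restriction map `M_k(C(D^n)) → M_k(C(S^{n-1}))`, where `M_k(C(X))` is `C(X, M_k)`. -/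
noncomputable def restrictBoundary {n k : ℕ} (g : C(Disk n, Mat k)) : C(DiskBoundary n, Mat k) :=
  g.comp (ContinuousMap.inclusion Metric.sphere_subset_closedBall)

/-- `A`, with the projections `πB` and `πD`, is the pullback `B ⊕_{M_k(C(S^{n-1}))} M_k(C(D^n))`
of the gluing map `φ` and the restriction map. -/
structure IsCellPullback {A B : Type u} [CStarAlgebra A] [CStarAlgebra B] {n k : ℕ}
    (φ : B →⋆ₐ[ℂ] C(DiskBoundary n, Mat k))
    (πB : A →⋆ₐ[ℂ] B) (πD : A →⋆ₐ[ℂ] C(Disk n, Mat k)) : Prop where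
  comm : ∀ a : A, φ (πB a) = restrictBoundary (πD a)
  existsUnique : ∀ (b : B) (g : C(Disk n, Mat k)), φ b = restrictBoundary g →
    ∃! a : A, πB a = b ∧ πD a = g

/-- Noncommutative cell complexes: the smallest class of C*-algebras that contains the
finite-dimensional ones and is closed under attaching cells `M_k(C(D^n))`. -/
inductive IsNCCC : (A : Type u) → [CStarAlgebra A] → Prop
  | finiteDimensional (A : Type u) [CStarAlgebra A] (hA : FiniteDimensional ℂ A) : IsNCCC A
  | attachCell (A B : Type u) [CStarAlgebra A] [CStarAlgebra B] (hB : IsNCCC B)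
      (n k : ℕ) (hk : 0 < k) (φ : B →⋆ₐ[ℂ] C(DiskBoundary n, Mat k))
      (πB : A →⋆ₐ[ℂ] B) (πD : A →⋆ₐ[ℂ] C(Disk n, Mat k))
      (hA : IsCellPullback φ πB πD) : IsNCCC A

section Traces

variable (A : Type u) [CStarAlgebra A] [PartialOrder A] [StarOrderedRing A]

/-- The tracial states `T(A)`. -/
def TracialState : Type u :=
  {τ : A →ₚ[ℂ] ℂ // τ 1 = 1 ∧ ∀ a b : A, τ (a * b) = τ (b * a)}

variable {A}

/-- `â(τ) = τ(a)` for `τ ∈ T(A)`; for self-adjoint `a` the value `τ(a)` is real. -/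
noncomputable def traceHat (a : A) : TracialState A → ℝ := fun τ => (τ.1 a).re

variable (A)

/-- The positive elements of norm at most `1` with `â ≠ 0`. -/
def PosUnitNeZero : Type u := {h : A // 0 ≤ h ∧ ‖h‖ ≤ 1 ∧ traceHat h ≠ 0}

/-- `A^+_{1,q} \ {0}`: the nonzero functions on `T(A)` of the form `ĥ`, where `h` is positive of
norm at most `1`, with the pointwise order. -/
abbrev AffPosUnitNeZero : Type u :=
  {f : TracialState A → ℝ // f ∈ traceHat '' {h : A | 0 ≤ h ∧ ‖h‖ ≤ 1} ∧ f ≠ 0}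

variable {A}

/-- The map `h ↦ ĥ` into `A^+_{1,q} \ {0}`. -/
noncomputable def PosUnitNeZero.hat (h : PosUnitNeZero A) : AffPosUnitNeZero A :=
  ⟨traceHat h.1, ⟨h.1, ⟨h.2.1, h.2.2.1⟩, rfl⟩, h.2.2.2⟩

end Traces

/-- The tracial state of `M_m`, evaluated at a matrix with real trace; more generally the value
at `x ⊕ 0 ∈ M_m` for a square block `x` of `M_m`. -/
noncomputable def normTr (m : ℕ) {r : ℕ} (x : Mat r) : ℝ := (Matrix.trace x).re / m

/-- `Φ = Φ₀ ⊕ Φ₁ ⊕ ⋯ ⊕ Φ₁` with `K` copies of `Φ₁`: a unitary `u` identifies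
`ℂ^{m₀} ⊕ (ℂ^{m₁})^K` with `ℂ^m` and carries the block diagonal map to `Φ`. -/
def IsMultDecomposition {A : Type u} [CStarAlgebra A] (K : ℕ) {m m₀ m₁ : ℕ}
    (Φ : A →⋆ₐ[ℂ] Mat m) (Φ₀ : A →⋆ₐ[ℂ] Mat m₀) (Φ₁ : A →⋆ₐ[ℂ] Mat m₁) : Prop :=
  ∃ u : Matrix (Fin m) (Fin m₀ ⊕ Fin m₁ × Fin K) ℂ,
    u * u.conjTranspose = 1 ∧ u.conjTranspose * u = 1 ∧
    ∀ a : A, Φ a = u * Matrix.fromBlocks (Φ₀ a) 0 0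
      (Matrix.blockDiagonal fun _ : Fin K => Φ₁ a) * u.conjTranspose

/-- Unitary equivalence of homomorphisms into `M_r`. -/
def UnitarilyEquivalent {A : Type u} [CStarAlgebra A] {r : ℕ} (Φ Ψ : A →⋆ₐ[ℂ] Mat r) : Prop :=
  ∃ w ∈ Matrix.unitaryGroup (Fin r) ℂ, ∀ a : A, Ψ a = w * Φ a * star w

/-! The proof compares multiplicities. A finite-dimensional representation of a noncommutative cell
complex splits into evaluations at points of the cells and representations of the initial
finite-dimensional algebra. The points may be moved a little without changing the values on `F` by
much, so up to `ε` only finitely many types `ρ j` of summands occur. The property `FinitelyTyped`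
says more: there are fixed elements `h j` such that the multiplicity of `ρ j`, in a suitable
perturbation of `φ`, is the unnormalized trace of `φ (h j)`, up to a total error of dimension `κ * m
+ C`.

This property is proved by induction over the cells. For a finite-dimensional algebra, minimal
projections count irreducible summands exactly. For an attached cell, a partition of unity spreads
each point fractionally over finitely many base points. The column sums of these fractions are
traces of elements of `A`, and `exists_rounding` turns the fractions into an honest assignment at a
cost of order square root of the number of points. Points sent to the boundary sphere become
representations of `B` and are passed to the induction hypothesis; this is why
`exists_adapted_partition` keeps boundary and interior members apart.

If `φ` and `ψ` have nearly equal traces on `H₂`, their perturbations have nearly equal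
multiplicities. Taking for each type the minimum of the two multiplicities, divided by `K` and
rounded down, gives the common summand `φ₁`. The remainder has dimension at most `θ * m`, once `m`
is large enough to absorb the additive constants. Largeness of `m` comes from infinite
dimensionality: `A` has arbitrarily many pairwise orthogonal elements, and the lower bounds by `Δ`
force `φ` to be nonzero on all of them. The same kind of bound keeps the trace of a positive `a`
with `traceHat a ≠ 0` away from zero, so a remainder of small dimension has small trace relative to
`a`. -/

/-! ### Orthogonal decompositions of representations -/

section Decompositions

open Matrix
open scoped Classical in
/-- An isometric decomposition of `ℂ^m` as an orthogonal direct sum of the spaces `ℂ^{d i}`. -/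
structure IsFrame {m : ℕ} {I : Type} [Fintype I] {d : I → ℕ}
    (V : ∀ i, Matrix (Fin m) (Fin (d i)) ℂ) : Prop where
  iso : ∀ i, (V i)ᴴ * V i = 1
  orth : ∀ i j, i ≠ j → (V i)ᴴ * V j = 0
  sum : ∑ i, V i * (V i)ᴴ = 1

namespace IsFrame

variable {m : ℕ} {I : Type} [Fintype I] {d : I → ℕ} {V : ∀ i, Matrix (Fin m) (Fin (d i)) ℂ}

theorem mul_sum (hV : IsFrame V) {l : ℕ} (i : I) (T : ∀ i, Matrix (Fin (d i)) (Fin l) ℂ) :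
    (V i)ᴴ * ∑ j, V j * T j = T i := by
  rw [Matrix.mul_sum, Finset.sum_eq_single i]
  · rw [← Matrix.mul_assoc, hV.iso, Matrix.one_mul]
  · intro j _ hj
    rw [← Matrix.mul_assoc, hV.orth i j hj.symm, Matrix.zero_mul]
  · simp

theorem sum_dim (hV : IsFrame V) : ∑ i, d i = m := by
  have h := congrArg Matrix.trace hV.sum
  rw [Matrix.trace_sum] at h
  have h2 : ∀ i, Matrix.trace (V i * (V i)ᴴ) = (d i : ℂ) := fun i => by
    rw [Matrix.trace_mul_comm, hV.iso, Matrix.trace_one, Fintype.card_fin]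
  simp only [h2, Matrix.trace_one, Fintype.card_fin] at h
  exact_mod_cast h

/-- The block diagonal embedding given by a frame. -/
noncomputable def glue (hV : IsFrame V) : (∀ i, Mat (d i)) →⋆ₐ[ℂ] Mat m where
  toFun T := ∑ i, V i * (T i * (V i)ᴴ)
  map_one' := by simpa using hV.sum
  map_mul' S T := by
    rw [Finset.sum_mul]
    refine Finset.sum_congr rfl fun i _ => ?_
    rw [Matrix.mul_assoc, Matrix.mul_assoc, hV.mul_sum i (fun j => T j * (V j)ᴴ)]
    simp [Matrix.mul_assoc]
  map_zero' := by simp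
  map_add' S T := by
    simp [Matrix.add_mul, Matrix.mul_add, Finset.sum_add_distrib]
  commutes' r := by
    have : ∀ i, V i * ((algebraMap ℂ (∀ i, Mat (d i)) r) i * (V i)ᴴ) = r • (V i * (V i)ᴴ) := by
      intro i
      simp [Algebra.algebraMap_eq_smul_one]
    rw [Finset.sum_congr rfl fun i _ => this i, ← Finset.smul_sum, hV.sum,
      Algebra.algebraMap_eq_smul_one]
  map_star' T := by
    rw [star_sum]
    refine Finset.sum_congr rfl fun i _ => ?_
    simp [Matrix.star_eq_conjTranspose, Matrix.mul_assoc]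

theorem glue_apply (hV : IsFrame V) (T : ∀ i, Mat (d i)) :
    hV.glue T = ∑ i, V i * (T i * (V i)ᴴ) := rfl

theorem norm_glue_le (hV : IsFrame V) (T : ∀ i, Mat (d i)) {r : ℝ} (hr : 0 ≤ r)
    (h : ∀ i, ‖T i‖ ≤ r) : ‖hV.glue T‖ ≤ r :=
  (NonUnitalStarAlgHom.norm_apply_le hV.glue T).trans ((pi_norm_le_iff_of_nonneg hr).2 h)

theorem trace_glue (hV : IsFrame V) (T : ∀ i, Mat (d i)) :
    (hV.glue T).trace = ∑ i, (T i).trace := by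
  rw [glue_apply, Matrix.trace_sum]
  refine Finset.sum_congr rfl fun i _ => ?_
  rw [Matrix.trace_mul_comm, Matrix.mul_assoc, hV.iso, Matrix.mul_one]

/-- The direct sum of representations on the summands of a frame. -/
noncomputable def glueRep (hV : IsFrame V) {A : Type u} [CStarAlgebra A]
    (g : ∀ i, A →⋆ₐ[ℂ] Mat (d i)) : A →⋆ₐ[ℂ] Mat m where
  toFun a := hV.glue fun i => g i a
  map_one' := by rw [← map_one hV.glue]; congr 1; ext1 i; simp
  map_mul' a b := by rw [← map_mul hV.glue]; congr 1; ext1 i; simp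
  map_zero' := by rw [← map_zero hV.glue]; congr 1; ext1 i; simp
  map_add' a b := by rw [← map_add hV.glue]; congr 1; ext1 i; simp
  commutes' r := by
    rw [← AlgHomClass.commutes hV.glue r]; congr 1; ext1 i; simp [AlgHomClass.commutes]
  map_star' a := by rw [← map_star hV.glue]; congr 1; ext1 i; simp [map_star]

end IsFrame

/-- A unital representation on some `ℂ^d`. -/
structure FRep (A : Type u) [CStarAlgebra A] where
  dim : ℕ
  hom : A →⋆ₐ[ℂ] Mat dim

/-- The pullback of a representation along a homomorphism. -/
def FRep.comp {A B : Type u} [CStarAlgebra A] [CStarAlgebra B] (ρ : FRep B) (π : A →⋆ₐ[ℂ] B) :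
    FRep A := ⟨ρ.dim, ρ.hom.comp π⟩

variable {A B : Type u} [CStarAlgebra A] [CStarAlgebra B]

/-- `φ` is unitarily equivalent to the direct sum of the `ρ i`. -/
def HasDecomp {m : ℕ} (φ : A →⋆ₐ[ℂ] Mat m) {I : Type} [Fintype I] (ρ : I → FRep A) : Prop :=
  ∃ V : ∀ i, Matrix (Fin m) (Fin (ρ i).dim) ℂ, IsFrame V ∧
    ∀ a, φ a = ∑ i, V i * ((ρ i).hom a * (V i)ᴴ)

namespace HasDecomp

variable {m : ℕ} {φ : A →⋆ₐ[ℂ] Mat m} {I : Type} [Fintype I] {ρ : I → FRep A}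

theorem sum_dim (h : HasDecomp φ ρ) : ∑ i, (ρ i).dim = m := by
  obtain ⟨V, hV, -⟩ := h
  exact hV.sum_dim

theorem trace (h : HasDecomp φ ρ) (a : A) : (φ a).trace = ∑ i, ((ρ i).hom a).trace := by
  obtain ⟨V, hV, h⟩ := h
  rw [h, ← hV.glue_apply, hV.trace_glue]

theorem comp (h : HasDecomp φ ρ) (π : B →⋆ₐ[ℂ] A) :
    HasDecomp (φ.comp π) (fun i => (ρ i).comp π) := by
  obtain ⟨V, hV, h⟩ := h
  exact ⟨V, hV, fun b => h (π b)⟩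

/-- The frame is kept and only the blocks change. The norm of a block diagonal matrix is bounded by
the largest block norm, so the error does not grow with the number of summands. -/
theorem perturb (h : HasDecomp φ ρ) (σ : I → FRep A) (F : Set A) {ε : ℝ} (hε : 0 ≤ ε)
    (hσ : ∀ i, ∃ g : A →⋆ₐ[ℂ] Mat (ρ i).dim, σ i = ⟨(ρ i).dim, g⟩ ∧
      ∀ f ∈ F, ‖g f - (ρ i).hom f‖ ≤ ε) :
    ∃ φ' : A →⋆ₐ[ℂ] Mat m, HasDecomp φ' σ ∧ ∀ f ∈ F, ‖φ' f - φ f‖ ≤ ε := by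
  obtain ⟨V, hV, h⟩ := h
  choose g hg hgF using hσ
  obtain rfl : σ = fun i => ⟨(ρ i).dim, g i⟩ := funext hg
  refine ⟨hV.glueRep g,
    ⟨V, hV, fun a => rfl⟩, fun f hf => ?_⟩
  change ‖hV.glue (fun i => g i f) - φ f‖ ≤ ε
  rw [h, ← hV.glue_apply, ← map_sub]
  exact hV.norm_glue_le _ hε fun i => hgF i f hf

theorem reindex (h : HasDecomp φ ρ) {I' : Type} [Fintype I'] (e : I' ≃ I) :
    HasDecomp φ (fun i => ρ (e i)) := by
  obtain ⟨V, hV, h⟩ := h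
  refine ⟨fun i => V (e i), ⟨fun i => hV.iso _, fun i j hij => hV.orth _ _ (by simpa using hij),
    ?_⟩, fun a => ?_⟩
  · rw [← hV.sum]
    exact e.sum_comp fun i => V i * (V i)ᴴ
  · rw [h]
    exact (e.sum_comp fun i => V i * ((ρ i).hom a * (V i)ᴴ)).symm

theorem group {J : I → Type} [∀ i, Fintype (J i)] {σ : ∀ i, J i → FRep A}
    (h : HasDecomp φ (fun p : Σ i, J i => σ p.1 p.2)) (hσ : ∀ i, HasDecomp (ρ i).hom (σ i)) :
    HasDecomp φ ρ := by
  obtain ⟨V, hV, h⟩ := h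
  choose W hW hσ using hσ
  have key : ∀ i (j : J i) {l : ℕ} (T : ∀ j, Matrix (Fin (σ i j).dim) (Fin l) ℂ),
      (V ⟨i, j⟩)ᴴ * ∑ j', V ⟨i, j'⟩ * T j' = T j := by
    intro i j l T
    rw [Matrix.mul_sum, Finset.sum_eq_single j]
    · rw [← Matrix.mul_assoc, hV.iso, Matrix.one_mul]
    · intro j' _ hj
      rw [← Matrix.mul_assoc, hV.orth ⟨i, j⟩ ⟨i, j'⟩ (by simpa using hj.symm), Matrix.zero_mul]
    · simp
  have hct : ∀ i, (∑ j, V ⟨i, j⟩ * (W i j)ᴴ)ᴴ = ∑ j, W i j * (V ⟨i, j⟩)ᴴ := fun i => by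
    simp [conjTranspose_sum]
  refine ⟨fun i => ∑ j, V ⟨i, j⟩ * (W i j)ᴴ, ⟨fun i => ?_, ?_, ?_⟩, fun a => ?_⟩
  · rw [hct, Matrix.sum_mul]
    simp only [Matrix.mul_assoc, key, (hW i).sum]
  · intro i i' hi
    rw [hct, Matrix.sum_mul]
    refine Finset.sum_eq_zero fun j _ => ?_
    rw [Matrix.mul_assoc, Matrix.mul_sum, Finset.sum_eq_zero, Matrix.mul_zero]
    intro j' _
    rw [← Matrix.mul_assoc, hV.orth ⟨i, j⟩ ⟨i', j'⟩ (by simp [hi]), Matrix.zero_mul]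
  · rw [← hV.sum, Fintype.sum_sigma]
    refine Finset.sum_congr rfl fun i _ => ?_
    rw [hct, Matrix.sum_mul]
    simp only [Matrix.mul_assoc]
    refine Finset.sum_congr rfl fun j _ => ?_
    rw [(hW i).mul_sum j (fun j => (V ⟨i, j⟩)ᴴ)]
  · rw [h, Fintype.sum_sigma]
    refine Finset.sum_congr rfl fun i _ => ?_
    rw [hct, Matrix.sum_mul]
    simp only [Matrix.mul_assoc]
    refine Finset.sum_congr rfl fun j _ => ?_
    rw [hσ i a, Matrix.sum_mul, Matrix.mul_sum]
    have h1 : ∀ j', W i j' * ((σ i j').hom a * (W i j')ᴴ) * ∑ j, W i j * (V ⟨i, j⟩)ᴴ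
        = W i j' * ((σ i j').hom a * (V ⟨i, j'⟩)ᴴ) := fun j' => by
      rw [Matrix.mul_assoc, Matrix.mul_assoc, (hW i).mul_sum j' (fun j => (V ⟨i, j⟩)ᴴ)]
    simp only [h1]
    rw [← Matrix.mul_sum, (hW i).mul_sum j (fun j => (σ i j).hom a * (V ⟨i, j⟩)ᴴ)]

end HasDecomp

open scoped Classical in
/-- The matrices that include the summands of `⊕ ℂ^{d i}`. -/
noncomputable def sumInclusion {I : Type} [Fintype I] (d : I → ℕ) (i : I) :
    Matrix (Fin (Fintype.card (Σ i, Fin (d i)))) (Fin (d i)) ℂ :=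
  fun x y => if (Fintype.equivFin (Σ i, Fin (d i))).symm x = ⟨i, y⟩ then 1 else 0

theorem isFrame_sumInclusion {I : Type} [Fintype I] (d : I → ℕ) : IsFrame (sumInclusion d) := by
  classical
  set e := (Fintype.equivFin (Σ i, Fin (d i))).symm with he
  have hgen : ∀ i j (y : Fin (d i)) (z : Fin (d j)),
      ((sumInclusion d i)ᴴ * sumInclusion d j) y z =
        if (⟨i, y⟩ : Σ i, Fin (d i)) = ⟨j, z⟩ then 1 else 0 := by
    intro i j y z
    rw [Matrix.mul_apply, ← e.symm.sum_comp]
    simp only [conjTranspose_apply, sumInclusion, ← he, Equiv.apply_symm_apply]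
    rw [Finset.sum_eq_single ⟨i, y⟩]
    · simp
    · intro b _ hb
      simp [hb]
    · simp
  refine ⟨fun i => ?_, fun i j hij => ?_, ?_⟩
  · ext y z
    rw [hgen, Matrix.one_apply]
    simp
  · ext y z
    rw [hgen]
    simp [hij]
  · ext x x'
    rw [Matrix.sum_apply, Matrix.one_apply]
    simp only [Matrix.mul_apply, conjTranspose_apply, sumInclusion, ← he]
    rw [← Fintype.sum_sigma (f := fun p : Σ i, Fin (d i) =>
      (if e x = ⟨p.1, p.2⟩ then (1 : ℂ) else 0) * star (if e x' = ⟨p.1, p.2⟩ then (1 : ℂ) else 0)),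
      Finset.sum_eq_single (e x)]
    · simp [eq_comm]
    · intro b _ hb
      simp [hb.symm]
    · simp

theorem FRep.exists_sum {I : Type} [Fintype I] (ρ : I → FRep A) :
    ∃ σ : FRep A, HasDecomp σ.hom ρ := by
  have hV := isFrame_sumInclusion (fun i => (ρ i).dim)
  exact ⟨⟨_, hV.glueRep fun i => (ρ i).hom⟩,
    _, hV, fun a => rfl⟩

end Decompositions

/-! ### Intertwiners and splitting off subrepresentations -/

section Intertwiners

open Matrix

variable {A : Type u} [CStarAlgebra A]

theorem star_mulVec_dotProduct_mulVec {m : ℕ} (φ : A →⋆ₐ[ℂ] Mat m) (a b : A) (v w : Fin m → ℂ) :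
    star (φ a *ᵥ v) ⬝ᵥ (φ b *ᵥ w) = star v ⬝ᵥ (φ (star a * b) *ᵥ w) := by
  rw [star_mulVec, ← dotProduct_mulVec, mulVec_mulVec, map_mul, map_star, star_eq_conjTranspose]

/-- Uniqueness in the GNS construction: a cyclic representation embeds isometrically into every
representation that has a vector with the same vector functional. -/
theorem exists_isometric_intertwiner {m d : ℕ} (φ : A →⋆ₐ[ℂ] Mat m) (ρ : A →⋆ₐ[ℂ] Mat d)
    (w : Fin d → ℂ) (w' : Fin m → ℂ) (hcyc : ∀ v, ∃ a, ρ a *ᵥ w = v)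
    (hst : ∀ a, star w' ⬝ᵥ (φ a *ᵥ w') = star w ⬝ᵥ (ρ a *ᵥ w)) :
    ∃ V : Matrix (Fin m) (Fin d) ℂ, Vᴴ * V = 1 ∧ ∀ a, φ a * V = V * ρ a := by
  have hin : ∀ a b, star (φ a *ᵥ w') ⬝ᵥ (φ b *ᵥ w') = star (ρ a *ᵥ w) ⬝ᵥ (ρ b *ᵥ w) := by
    intro a b
    rw [star_mulVec_dotProduct_mulVec, star_mulVec_dotProduct_mulVec, hst]
  -- Equality of the vector functionals makes the assignment `ρ a *ᵥ w ↦ φ a *ᵥ w'` well defined and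
  -- isometric.
  have hzero : ∀ a, ρ a *ᵥ w = 0 → φ a *ᵥ w' = 0 := by
    intro a ha
    have h := hin a a
    rw [ha, dotProduct_zero] at h
    exact dotProduct_star_self_eq_zero.1 h
  have heq : ∀ a b, ρ a *ᵥ w = ρ b *ᵥ w → φ a *ᵥ w' = φ b *ᵥ w' := by
    intro a b hab
    have := hzero (a - b) (by rw [map_sub, sub_mulVec, hab, sub_self])
    rwa [map_sub, sub_mulVec, sub_eq_zero] at this
  choose c hc using fun i : Fin d => hcyc (Pi.single i 1)
  let V : Matrix (Fin m) (Fin d) ℂ := of fun x i => (φ (c i) *ᵥ w') x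
  have hVs : ∀ i, V *ᵥ Pi.single i 1 = φ (c i) *ᵥ w' := by
    intro i
    ext x
    simp [V]
  have hV : ∀ b, V *ᵥ (ρ b *ᵥ w) = φ b *ᵥ w' := by
    intro b
    set v := ρ b *ᵥ w with hv
    have h1 : V *ᵥ v = φ (∑ i, v i • c i) *ᵥ w' := by
      rw [map_sum, sum_mulVec]
      ext x
      simp only [V, map_smul, smul_mulVec, Finset.sum_apply, Pi.smul_apply, smul_eq_mul]
      rw [mulVec, dotProduct]
      exact Finset.sum_congr rfl fun i _ => mul_comm _ _
    have h2 : ρ (∑ i, v i • c i) *ᵥ w = v := by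
      rw [map_sum, sum_mulVec]
      simp only [map_smul, smul_mulVec, hc]
      ext x
      simp [Finset.sum_apply, Pi.single_apply]
    rw [h1]
    exact heq _ _ (h2.trans hv)
  refine ⟨V, ?_, fun a => ?_⟩
  · ext i j
    have : (Vᴴ * V) i j = star (φ (c i) *ᵥ w') ⬝ᵥ (φ (c j) *ᵥ w') := by
      simp [V, Matrix.mul_apply, dotProduct]
    rw [this, hin, hc, hc]
    simp [Matrix.one_apply, Pi.single_apply, eq_comm]
  · apply Matrix.ext_of_mulVec_single
    intro i
    have h := hV (a * c i)
    rw [map_mul, map_mul, ← mulVec_mulVec, ← mulVec_mulVec, hc] at h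
    rw [← mulVec_mulVec, ← mulVec_mulVec, hVs, h]

theorem exists_orthogonal_complement {m d : ℕ} (V : Matrix (Fin m) (Fin d) ℂ) (hV : Vᴴ * V = 1) :
    ∃ (m' : ℕ) (U : Matrix (Fin m) (Fin m') ℂ), m' + d = m ∧ Uᴴ * U = 1 ∧ Vᴴ * U = 0 ∧
      V * Vᴴ + U * Uᴴ = 1 := by
  let T := toEuclideanLin Vᴴ
  let W := LinearMap.ker T
  let b := stdOrthonormalBasis ℂ W
  have hT : Function.Surjective T := by
    intro v
    refine ⟨toEuclideanLin V v, ?_⟩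
    simp [T, toLpLin_apply, mulVec_mulVec, hV]
  have hdim : Module.finrank ℂ W + d = m := by
    have h := T.finrank_range_add_finrank_ker
    rw [LinearMap.range_eq_top.2 hT, finrank_top, finrank_euclideanSpace_fin,
      finrank_euclideanSpace_fin] at h
    rw [add_comm]
    exact h
  let U : Matrix (Fin m) (Fin (Module.finrank ℂ W)) ℂ := of fun x j => (b j : EuclideanSpace ℂ _) x
  have hU : Uᴴ * U = 1 := by
    ext i j
    have h := orthonormal_iff_ite.1 b.orthonormal i j
    rw [Matrix.one_apply, ← h, Submodule.coe_inner, EuclideanSpace.inner_eq_star_dotProduct,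
      dotProduct_comm]
    simp [U, Matrix.mul_apply, dotProduct]
  have hVU : Vᴴ * U = 0 := by
    ext i j
    have h : T (b j : EuclideanSpace ℂ (Fin m)) = 0 := (b j).2
    exact congrArg (fun v => v i) h
  have hUV : Uᴴ * V = 0 := by
    rw [← conjTranspose_conjTranspose V, ← conjTranspose_mul, hVU, conjTranspose_zero]
  refine ⟨_, U, hdim, hU, hVU, ?_⟩
  -- The combined matrix is square by the dimension count, so its left inverse is a right inverse;
  -- this is the resolution of the identity.
  have h1 : (fromCols V U)ᴴ * fromCols V U = 1 := by
    rw [conjTranspose_fromCols_eq_fromRows_conjTranspose, fromRows_mul_fromCols, hV, hU, hVU, hUV,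
      fromBlocks_one]
  rw [Matrix.mul_eq_one_comm_of_card_eq _ _ _ (by simp; omega),
    conjTranspose_fromCols_eq_fromRows_conjTranspose, fromCols_mul_fromRows] at h1
  exact h1

/-- A subrepresentation can be split off. -/
theorem exists_complement_rep {m d : ℕ} (φ : A →⋆ₐ[ℂ] Mat m) (ρ : A →⋆ₐ[ℂ] Mat d)
    (V : Matrix (Fin m) (Fin d) ℂ) (hV : Vᴴ * V = 1) (hφ : ∀ a, φ a * V = V * ρ a) :
    ∃ σ : FRep A, σ.dim + d = m ∧ ∀ {I : Type} [Fintype I] (τ : I → FRep A),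
      HasDecomp σ.hom τ → HasDecomp φ (fun o : Option I => o.elim ⟨d, ρ⟩ τ) := by
  obtain ⟨m', U, hdim, hU, hVU, hsum⟩ := exists_orthogonal_complement V hV
  have hUV : Uᴴ * V = 0 := by
    rw [← conjTranspose_conjTranspose V, ← conjTranspose_mul, hVU, conjTranspose_zero]
  -- The adjoint relation, obtained from `star a`, makes the orthogonal complement invariant as
  -- well.
  have hVφ : ∀ a, Vᴴ * φ a = ρ a * Vᴴ := by
    intro a
    have h := congrArg conjTranspose (hφ (star a))
    simpa [map_star, star_eq_conjTranspose] using h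
  have hφU : ∀ a, φ a * U = U * (Uᴴ * (φ a * U)) := by
    intro a
    calc φ a * U = (V * Vᴴ + U * Uᴴ) * (φ a * U) := by rw [hsum, Matrix.one_mul]
      _ = V * ((Vᴴ * φ a) * U) + U * (Uᴴ * (φ a * U)) := by
        simp only [Matrix.add_mul, Matrix.mul_assoc]
      _ = _ := by rw [hVφ, Matrix.mul_assoc, hVU]; simp
  let s : A →⋆ₐ[ℂ] Mat m' :=
    { toFun := fun a => Uᴴ * (φ a * U)
      map_one' := by simp [hU]
      map_mul' := fun a b => by
        calc Uᴴ * (φ (a * b) * U) = Uᴴ * (φ a * (φ b * U)) := by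
              rw [map_mul, Matrix.mul_assoc (φ a)]
          _ = Uᴴ * (φ a * (U * (Uᴴ * (φ b * U)))) := by rw [← hφU b]
          _ = _ := by simp only [Matrix.mul_assoc]
      map_zero' := by simp
      map_add' := fun a b => by simp [Matrix.add_mul, Matrix.mul_add]
      commutes' := fun r => by simp [Algebra.algebraMap_eq_smul_one, hU]
      map_star' := fun a => by
        simp [map_star, star_eq_conjTranspose, Matrix.mul_assoc] }
  have hφdec : ∀ a, φ a = V * (ρ a * Vᴴ) + U * (s a * Uᴴ) := by
    intro a
    calc φ a = φ a * (V * Vᴴ + U * Uᴴ) := by rw [hsum, Matrix.mul_one]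
      _ = φ a * V * Vᴴ + φ a * U * Uᴴ := by simp only [Matrix.mul_add, Matrix.mul_assoc]
      _ = _ := by rw [hφ, hφU a, Matrix.mul_assoc, Matrix.mul_assoc]; rfl
  refine ⟨⟨m', s⟩, hdim, ?_⟩
  intro I _ τ hτ
  obtain ⟨W, hW, hτ⟩ := hτ
  have hUW : ∀ i j, (U * W i)ᴴ * (U * W j) = (W i)ᴴ * W j := fun i j => by
    rw [conjTranspose_mul, Matrix.mul_assoc, ← Matrix.mul_assoc Uᴴ, hU, Matrix.one_mul]
  refine ⟨fun o => match o with
    | none => V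
    | some i => U * W i, ⟨?_, ?_, ?_⟩, fun a => ?_⟩
  · rintro (_ | i)
    · exact hV
    · exact (hUW i i).trans (hW.iso i)
  · rintro (_ | i) (_ | j) hij
    · exact absurd rfl hij
    · change Vᴴ * (U * W j) = 0
      rw [← Matrix.mul_assoc, hVU, Matrix.zero_mul]
    · change (U * W i)ᴴ * V = 0
      rw [conjTranspose_mul, Matrix.mul_assoc, hUV, Matrix.mul_zero]
    · exact (hUW i j).trans (hW.orth i j (by simpa using hij))
  · rw [Fintype.sum_option, ← hsum]
    congr 1
    change ∑ i, U * W i * (U * W i)ᴴ = _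
    have h := congrArg (fun X => U * (X * Uᴴ)) hW.sum
    simpa only [Matrix.sum_mul, Matrix.mul_sum, Matrix.one_mul, Matrix.mul_assoc,
      conjTranspose_mul] using h
  · rw [Fintype.sum_option, hφdec]
    congr 1
    change U * (s a * Uᴴ) = ∑ i, U * W i * ((τ i).hom a * (U * W i)ᴴ)
    rw [show s a = _ from hτ a, Matrix.sum_mul, Matrix.mul_sum]
    refine Finset.sum_congr rfl fun i _ => ?_
    simp only [conjTranspose_mul, Matrix.mul_assoc]

theorem hasDecomp_empty (φ : A →⋆ₐ[ℂ] Mat 0) (ρ : Empty → FRep A) : HasDecomp φ ρ :=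
  ⟨fun i => i.elim, ⟨fun i => i.elim, fun i => i.elim, Subsingleton.elim _ _⟩,
    fun _ => Subsingleton.elim _ _⟩

theorem hasDecomp_self {m : ℕ} (φ : A →⋆ₐ[ℂ] Mat m) : HasDecomp φ (fun _ : Unit => ⟨m, φ⟩) :=
  ⟨fun _ => (1 : Mat m), ⟨fun _ => by simp, fun i j h => absurd (Subsingleton.elim i j) h,
    by simp⟩, fun a => by simp⟩

end Intertwiners

/-! ### Minimal projections and irreducible representations of finite-dimensional algebras -/

section MinimalProjections

variable {A : Type u} [CStarAlgebra A]

/-- Nonzero projections `p` with `pAp = ℂp`. -/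
structure IsMinimalProjection (p : A) : Prop where
  isStarProjection : IsStarProjection p
  ne_zero : p ≠ 0
  corner : ∀ a, ∃ c : ℂ, p * a * p = c • p

/-- The compression `a ↦ qaq`. -/
noncomputable def cornerMap (q : A) : A →ₗ[ℂ] A :=
  LinearMap.mulRight ℂ q ∘ₗ LinearMap.mulLeft ℂ q

theorem cornerMap_apply (q a : A) : cornerMap q a = q * a * q := rfl

theorem spectrum_real_finite [FiniteDimensional ℂ A] (b : A) : (spectrum ℝ b).Finite := by
  have : FiniteDimensional ℝ A := FiniteDimensional.complexToReal A
  nontriviality A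
  have hb : IsIntegral ℝ b := Algebra.IsIntegral.isIntegral b
  refine ((minpoly ℝ b).roots.toFinset.finite_toSet).subset fun r hr => ?_
  have h := spectrum.subset_polynomial_aeval b (minpoly ℝ b) ⟨r, hr, rfl⟩
  rw [minpoly.aeval, spectrum.zero_eq] at h
  simpa [minpoly.ne_zero hb] using h

open Classical in
/-- A projection whose corner is not `ℂq` has a proper nonzero subprojection. -/
theorem exists_subprojection [FiniteDimensional ℂ A] {q : A} (hq : IsStarProjection q)
    (hq0 : q ≠ 0) (hmin : ¬ IsMinimalProjection q) :
    ∃ e : A, IsStarProjection e ∧ e * q = e ∧ q * e = e ∧ e ≠ 0 ∧ e ≠ q := by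
  by_contra! hcon
  have hqq : q * q = q := hq.isIdempotentElem
  have hsa : ∀ b : A, IsSelfAdjoint b → ∃ c : ℂ, q * b * q = c • q := by
    intro b₀ hb₀
    set b := q * b₀ * q with hb
    have hbsa : IsSelfAdjoint b := by
      rw [IsSelfAdjoint, hb, star_mul, star_mul, hq.isSelfAdjoint.star_eq, hb₀.star_eq, mul_assoc]
    have hbq : b * q = b := by rw [hb, mul_assoc, hqq]
    have hqb : q * b = b := by rw [hb, ← mul_assoc, ← mul_assoc, hqq]
    -- On a finite spectrum every function is continuous, so indicator functions yield spectral
    -- projections. The nonzero `P r * q` are subprojections of `q`, hence equal to `q`, which makes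
    -- `b` scalar on `q`.
    have hfin := spectrum_real_finite b
    have hcont : ∀ f : ℝ → ℝ, ContinuousOn f (spectrum ℝ b) := hfin.continuousOn
    let f : ℝ → ℝ → ℝ := fun r x => if x = r then 1 else 0
    let P : ℝ → A := fun r => cfc (f r) b
    have hP : ∀ r, IsStarProjection (P r) := fun r => by
      refine ⟨?_, cfc_predicate (f r) b⟩
      rw [IsIdempotentElem, ← cfc_mul (f r) (f r) b (hcont _) (hcont _)]
      congr 1
      ext x
      simp [f]
    have hPq : ∀ r, Commute (P r) q := fun r =>
      Commute.cfc_real (show b * q = q * b by rw [hbq, hqb]) (f r)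
    have hsum : ∑ r ∈ hfin.toFinset, P r = 1 := by
      rw [← cfc_sum f b _ fun i _ => hcont _]
      rw [← cfc_one ℝ b]
      refine cfc_congr fun x hx => ?_
      simpa [f] using hx
    have hbP : ∀ r, b * P r = r • P r := by
      intro r
      conv_lhs => rw [← cfc_id' ℝ b]
      rw [← cfc_mul (fun x => x) (f r) b (hcont _) (hcont _),
        ← cfc_smul r (f r) b (hcont _)]
      congr 1
      ext x
      by_cases hx : x = r <;> simp [f, hx]
    obtain ⟨r, -, hr⟩ : ∃ r ∈ hfin.toFinset, P r * q ≠ 0 := by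
      by_contra! h
      apply hq0
      calc q = (∑ r ∈ hfin.toFinset, P r) * q := by rw [hsum, one_mul]
        _ = 0 := by rw [Finset.sum_mul, Finset.sum_eq_zero h]
    have hr1 : P r * q = q := by
      refine hcon (P r * q) ((hP r).mul hq (hPq r)) ?_ ?_ hr
      · rw [mul_assoc, hqq]
      · rw [← mul_assoc, ← (hPq r).eq, mul_assoc, hqq]
    refine ⟨r, ?_⟩
    calc b = b * (P r * q) := by rw [hr1, hbq]
      _ = r • (P r * q) := by rw [← mul_assoc, hbP, smul_mul_assoc]
      _ = (r : ℂ) • q := by rw [hr1, Complex.coe_smul]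
  refine hmin ⟨hq, hq0, fun a => ?_⟩
  obtain ⟨c, hc⟩ := hsa _ (realPart a).2
  obtain ⟨c', hc'⟩ := hsa _ (imaginaryPart a).2
  refine ⟨c + Complex.I * c', ?_⟩
  conv_lhs => rw [← realPart_add_I_smul_imaginaryPart a]
  rw [mul_add, add_mul, hc, mul_smul_comm, smul_mul_assoc, hc', add_smul, mul_smul]

/-- A projection that is nonzero and not minimal splits as `e + (q - e)`, and both parts have
corners of strictly smaller dimension than `qAq`. -/
theorem mem_span_minimalProjection [FiniteDimensional ℂ A] (q : A) (hq : IsStarProjection q) :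
    q ∈ Submodule.span ℂ {p : A | IsMinimalProjection p} := by
  induction hn : Module.finrank ℂ (LinearMap.range (cornerMap q)) using Nat.strong_induction_on
    generalizing q with
  | _ n ih =>
    by_cases hq0 : q = 0
    · rw [hq0]; exact Submodule.zero_mem _
    by_cases hmin : IsMinimalProjection q
    · exact Submodule.subset_span hmin
    obtain ⟨e, he, heq, hqe, he0, hne⟩ := exists_subprojection hq hq0 hmin
    have hqq : q * q = q := hq.isIdempotentElem
    have hlt : ∀ e : A, e * e = e → e * q = e → q * e = e → e ≠ q →
        Module.finrank ℂ (LinearMap.range (cornerMap e)) < n := by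
      intro e hee heq hqe hne
      rw [← hn]
      apply Submodule.finrank_lt_finrank_of_lt
      rw [SetLike.lt_iff_le_and_exists]
      constructor
      · rintro _ ⟨a, rfl⟩
        refine ⟨e * a * e, ?_⟩
        rw [cornerMap_apply, cornerMap_apply, ← mul_assoc, ← mul_assoc, hqe, mul_assoc, heq]
      · refine ⟨q, ⟨q, by rw [cornerMap_apply, hqq, hqq]⟩, ?_⟩
        rintro ⟨a, ha⟩
        rw [cornerMap_apply] at ha
        apply hne
        rw [← heq, ← ha, ← mul_assoc, ← mul_assoc, hee]
    have hee : e * e = e := he.isIdempotentElem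
    have h1 := ih _ (hlt e hee heq hqe hne) e he rfl
    have hf : IsStarProjection (q - e) := by
      refine ⟨?_, hq.isSelfAdjoint.sub he.isSelfAdjoint⟩
      rw [IsIdempotentElem, mul_sub, sub_mul, sub_mul, hqq, heq, hqe, hee]
      abel
    have h2 := ih _ (hlt (q - e) hf.isIdempotentElem (by rw [sub_mul, hqq, heq])
      (by rw [mul_sub, hqq, hqe]) (by simpa using he0)) (q - e) hf rfl
    simpa using Submodule.add_mem _ h1 h2

/-- A maximal family of inequivalent minimal projections. -/
theorem exists_inequivalent_minimalProjections [FiniteDimensional ℂ A] :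
    ∃ T : Finset A, (∀ p ∈ T, IsMinimalProjection p) ∧
      (∀ p ∈ T, ∀ q ∈ T, p ≠ q → ∀ a, p * a * q = 0) ∧
      ∀ {m : ℕ} (φ : A →⋆ₐ[ℂ] Mat m), (∀ p ∈ T, φ p = 0) → m = 0 := by
  classical
  obtain ⟨S, hS, h1⟩ := Submodule.mem_span_finite_of_mem_span
    (mem_span_minimalProjection (1 : A) (.one A))
  let R : Finset (Finset A) := S.powerset.filter fun T =>
    ∀ p ∈ T, ∀ q ∈ T, p ≠ q → ∀ a, p * a * q = 0
  obtain ⟨T, hT, hmax⟩ := R.exists_max_image Finset.card ⟨∅, by simp [R]⟩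
  rw [Finset.mem_filter, Finset.mem_powerset] at hT
  refine ⟨T, fun p hp => hS (hT.1 hp), hT.2, fun {m} φ hφ => ?_⟩
  have hφS : ∀ q ∈ S, φ q = 0 := by
    intro q hq
    have hqm : IsMinimalProjection q := hS hq
    by_contra hφq
    have hqT : q ∉ T := fun h => hφq (hφ q h)
    have hex : ∃ p ∈ T, ∃ a, p * a * q ≠ 0 := by
      by_contra! hcon
      have hcon' : ∀ p ∈ T, ∀ a, q * a * p = 0 := by
        intro p hp a
        have h := congrArg star (hcon p hp (star a))
        rw [star_mul, star_mul, star_star, hqm.isStarProjection.isSelfAdjoint.star_eq,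
          (hS (hT.1 hp)).isStarProjection.isSelfAdjoint.star_eq, star_zero, ← mul_assoc] at h
        exact h
      have hins : insert q T ∈ R := by
        rw [Finset.mem_filter, Finset.mem_powerset]
        refine ⟨Finset.insert_subset hq hT.1, ?_⟩
        intro p hp p' hp' hne a
        rw [Finset.mem_insert] at hp hp'
        rcases hp with rfl | hp <;> rcases hp' with rfl | hp'
        · exact absurd rfl hne
        · exact hcon' _ hp' a
        · exact hcon _ hp a
        · exact hT.2 p hp p' hp' hne a
      have := hmax _ hins
      rw [Finset.card_insert_of_notMem hqT] at this
      omega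
    obtain ⟨p, hp, a, ha⟩ := hex
    -- With `x = p * a * q`, minimality of `q` gives `star x * x = c • q` with `c ≠ 0`. Hence a
    -- homomorphism that kills `p` kills `q`.
    obtain ⟨c, hc⟩ := hqm.corner (star a * p * a)
    have hpp : p * p = p := (hS (hT.1 hp)).isStarProjection.isIdempotentElem
    have hst : star (p * a * q) * (p * a * q) = c • q := by
      rw [← hc, star_mul, star_mul, hqm.isStarProjection.isSelfAdjoint.star_eq,
        (hS (hT.1 hp)).isStarProjection.isSelfAdjoint.star_eq]
      simp only [mul_assoc]
      rw [← mul_assoc p p, hpp]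
    have hc0 : c ≠ 0 := by
      rintro rfl
      rw [zero_smul, CStarRing.star_mul_self_eq_zero_iff] at hst
      exact ha hst
    have h := congrArg φ hst
    rw [map_mul, map_mul, map_mul, hφ p hp, zero_mul, zero_mul, mul_zero, map_smul] at h
    exact hφq ((smul_eq_zero.1 h.symm).resolve_left hc0)
  have hφ1 : φ 1 = 0 := by
    have : Submodule.span ℂ (S : Set A) ≤ LinearMap.ker φ.toAlgHom.toLinearMap :=
      Submodule.span_le.2 fun q hq => hφS q hq
    exact this h1
  rw [map_one] at hφ1
  by_contra hm
  have := congrFun (congrFun hφ1 ⟨0, Nat.pos_of_ne_zero hm⟩) ⟨0, Nat.pos_of_ne_zero hm⟩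
  simp at this

open Matrix

/-- The cyclic subrepresentation generated by a vector. -/
theorem exists_cyclic_subrep {m : ℕ} (φ : A →⋆ₐ[ℂ] Mat m) (w : Fin m → ℂ) :
    ∃ (ρ : FRep A) (w₀ : Fin ρ.dim → ℂ), (∀ v, ∃ a, ρ.hom a *ᵥ w₀ = v) ∧
      ∀ a, star w₀ ⬝ᵥ (ρ.hom a *ᵥ w₀) = star w ⬝ᵥ (φ a *ᵥ w) := by
  let L : A →ₗ[ℂ] EuclideanSpace ℂ (Fin m) :=
    { toFun := fun a => WithLp.toLp 2 (φ a *ᵥ w)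
      map_add' := fun a b => by simp [add_mulVec]
      map_smul' := fun c a => by simp [smul_mulVec] }
  let W := LinearMap.range L
  let b := stdOrthonormalBasis ℂ W
  let d := Module.finrank ℂ W
  let U : Matrix (Fin m) (Fin d) ℂ := of fun x j => (b j : EuclideanSpace ℂ _) x
  have hU : Uᴴ * U = 1 := by
    ext i j
    have h := orthonormal_iff_ite.1 b.orthonormal i j
    rw [Matrix.one_apply, ← h, Submodule.coe_inner, EuclideanSpace.inner_eq_star_dotProduct,
      dotProduct_comm]
    simp [U, Matrix.mul_apply, dotProduct]
  have hUmul : ∀ v : Fin d → ℂ, U *ᵥ v = ((∑ j, v j • b j : W) : EuclideanSpace ℂ (Fin m)) := by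
    intro v
    ext x
    simp only [mulVec, dotProduct, U, of_apply]
    simp [mul_comm]
  have hUW : ∀ v : Fin d → ℂ, ∃ a, U *ᵥ v = φ a *ᵥ w := by
    intro v
    obtain ⟨a, ha⟩ := (∑ j, v j • b j : W).2
    exact ⟨a, (hUmul v).trans (congrArg WithLp.ofLp ha.symm)⟩
  have hUr : ∀ a, U *ᵥ (Uᴴ *ᵥ (φ a *ᵥ w)) = φ a *ᵥ w := by
    intro a
    let z : W := ⟨L a, a, rfl⟩
    have h : U *ᵥ (fun j => b.repr z j) = φ a *ᵥ w := by
      rw [hUmul, b.sum_repr z]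
      rfl
    rw [← h, mulVec_mulVec _ Uᴴ, hU, one_mulVec]
  have hφU : ∀ a, φ a * U = U * (Uᴴ * (φ a * U)) := by
    intro a
    apply Matrix.ext_of_mulVec_single
    intro i
    obtain ⟨a', ha'⟩ := hUW (Pi.single i 1)
    simp only [← mulVec_mulVec]
    rw [ha', mulVec_mulVec _ (φ a), ← map_mul, hUr]
  let s : A →⋆ₐ[ℂ] Mat d :=
    { toFun := fun a => Uᴴ * (φ a * U)
      map_one' := by simp [hU]
      map_mul' := fun a b => by
        calc Uᴴ * (φ (a * b) * U) = Uᴴ * (φ a * (φ b * U)) := by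
              rw [map_mul, Matrix.mul_assoc (φ a)]
          _ = Uᴴ * (φ a * (U * (Uᴴ * (φ b * U)))) := by rw [← hφU b]
          _ = _ := by simp only [Matrix.mul_assoc]
      map_zero' := by simp
      map_add' := fun a b => by simp [Matrix.add_mul, Matrix.mul_add]
      commutes' := fun r => by simp [Algebra.algebraMap_eq_smul_one, hU]
      map_star' := fun a => by
        simp [map_star, star_eq_conjTranspose, Matrix.mul_assoc] }
  have hw : U *ᵥ (Uᴴ *ᵥ w) = w := by simpa using hUr 1
  have hs : ∀ a, s a *ᵥ (Uᴴ *ᵥ w) = Uᴴ *ᵥ (φ a *ᵥ w) := by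
    intro a
    change (Uᴴ * (φ a * U)) *ᵥ (Uᴴ *ᵥ w) = _
    rw [← mulVec_mulVec, ← mulVec_mulVec, hw]
  refine ⟨⟨d, s⟩, Uᴴ *ᵥ w, fun v => ?_, fun a => ?_⟩
  · obtain ⟨a, ha⟩ := hUW v
    refine ⟨a, ?_⟩
    change s a *ᵥ _ = _
    rw [hs, ← ha, mulVec_mulVec, hU, one_mulVec]
  · change star (Uᴴ *ᵥ w) ⬝ᵥ (s a *ᵥ (Uᴴ *ᵥ w)) = _
    rw [hs, star_mulVec, conjTranspose_conjTranspose, ← dotProduct_mulVec, hUr]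

theorem exists_unit_fixed_vector {p : A} (hp : p * p = p) {m : ℕ} (φ : A →⋆ₐ[ℂ] Mat m)
    (hφ : φ p ≠ 0) : ∃ w : Fin m → ℂ, star w ⬝ᵥ w = 1 ∧ φ p *ᵥ w = w := by
  obtain ⟨v, hv⟩ : ∃ v, φ p *ᵥ v ≠ 0 := by
    by_contra! h
    apply hφ
    apply Matrix.ext_of_mulVec_single
    intro i
    rw [h, zero_mulVec]
  set x := φ p *ᵥ v with hx
  have hpx : φ p *ᵥ x = x := by rw [hx, mulVec_mulVec, ← map_mul, hp]
  have hx0 : ‖WithLp.toLp 2 x‖ ≠ 0 := by simpa using hv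
  have hxx : star x ⬝ᵥ x = ((‖WithLp.toLp 2 x‖ : ℝ) : ℂ) ^ 2 := by
    have h := inner_self_eq_norm_sq_to_K (𝕜 := ℂ) (WithLp.toLp 2 x)
    rw [EuclideanSpace.inner_eq_star_dotProduct, dotProduct_comm] at h
    exact h
  have hx0' : ((‖WithLp.toLp 2 x‖ : ℝ) : ℂ) ≠ 0 := by exact_mod_cast hx0
  refine ⟨((‖WithLp.toLp 2 x‖ : ℝ) : ℂ)⁻¹ • x, ?_, by rw [mulVec_smul, hpx]⟩
  rw [star_smul, smul_dotProduct, dotProduct_smul, hxx]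
  simp only [star_inv₀, Complex.star_def, Complex.conj_ofReal, smul_eq_mul]
  field_simp

/-- The irreducible representation that belongs to a minimal projection. -/
theorem IsMinimalProjection.exists_rep {p : A} (hp : IsMinimalProjection p) {m₀ : ℕ}
    (φ₀ : A →⋆ₐ[ℂ] Mat m₀) (hφ₀ : φ₀ p ≠ 0) :
    ∃ ρ : FRep A, 0 < ρ.dim ∧ (ρ.hom p).trace = 1 ∧
      (∀ q : A, (∀ a, q * a * p = 0) → ρ.hom q = 0) ∧
      ∀ {m : ℕ} (φ : A →⋆ₐ[ℂ] Mat m), φ p ≠ 0 →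
        ∃ V : Matrix (Fin m) (Fin ρ.dim) ℂ, Vᴴ * V = 1 ∧ ∀ a, φ a * V = V * ρ.hom a := by
  have hpp : p * p = p := hp.isStarProjection.isIdempotentElem
  have hps : star p = p := hp.isStarProjection.isSelfAdjoint.star_eq
  choose c hc using hp.corner
  -- Every unit vector fixed by `p`, in any representation, induces the same state `c`. GNS
  -- uniqueness then embeds one cyclic model into all representations that do not kill `p`.
  have hstate : ∀ {m : ℕ} (φ : A →⋆ₐ[ℂ] Mat m) (w : Fin m → ℂ), star w ⬝ᵥ w = 1 →
      φ p *ᵥ w = w → ∀ a, star w ⬝ᵥ (φ a *ᵥ w) = c a := by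
    intro m φ w hw hpw a
    calc star w ⬝ᵥ (φ a *ᵥ w) = star (φ p *ᵥ w) ⬝ᵥ (φ (a * p) *ᵥ w) := by
          rw [map_mul, ← mulVec_mulVec, hpw]
      _ = star w ⬝ᵥ (φ (p * a * p) *ᵥ w) := by
          rw [star_mulVec_dotProduct_mulVec, hps, mul_assoc]
      _ = c a := by
          rw [hc, map_smul, smul_mulVec, hpw, dotProduct_smul, hw, smul_eq_mul, mul_one]
  obtain ⟨v, hv, hpv⟩ := exists_unit_fixed_vector hpp φ₀ hφ₀
  obtain ⟨ρ, w, hcyc, hw⟩ := exists_cyclic_subrep φ₀ v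
  have hww : star w ⬝ᵥ w = 1 := by
    have := hw 1
    rwa [map_one, map_one, one_mulVec, one_mulVec, hv] at this
  have hwc : ∀ a, star w ⬝ᵥ (ρ.hom a *ᵥ w) = c a := fun a => by
    rw [hw, hstate φ₀ v hv hpv]
  have hpw : ρ.hom p *ᵥ w = w := by
    -- The norm of `(p - 1)w` depends only on the state, so it may be computed at the original
    -- vector `v`.
    have h1 : star (ρ.hom (p - 1) *ᵥ w) ⬝ᵥ (ρ.hom (p - 1) *ᵥ w) = 0 := by
      have : star (p - 1) * (p - 1) = 1 - p := by
        rw [star_sub, hps, star_one, mul_sub, sub_mul, hpp]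
        simp
      rw [star_mulVec_dotProduct_mulVec, this, hw, map_sub, sub_mulVec, hpv, map_one, one_mulVec,
        sub_self, dotProduct_zero]
    rw [dotProduct_star_self_eq_zero, map_sub, sub_mulVec, map_one, one_mulVec, sub_eq_zero] at h1
    exact h1
  refine ⟨ρ, ?_, ?_, fun q hq => ?_, fun {m} φ hφ => ?_⟩
  · rcases Nat.eq_zero_or_pos ρ.dim with h0 | h0
    · exfalso
      have : star w ⬝ᵥ w = 0 := by
        have : IsEmpty (Fin ρ.dim) := by rw [h0]; infer_instance
        simp [dotProduct]
      rw [this] at hww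
      exact zero_ne_one hww
    · exact h0
  -- By minimality `p` acts as the rank-one projection onto the cyclic vector, so its trace counts
  -- copies of `ρ`.
  · have : ρ.hom p = vecMulVec w (star w) := by
      apply Matrix.ext_of_mulVec_single
      intro i
      obtain ⟨a, ha⟩ := hcyc (Pi.single i 1)
      rw [← ha, vecMulVec_mulVec, hwc]
      calc ρ.hom p *ᵥ (ρ.hom a *ᵥ w) = ρ.hom (p * a * p) *ᵥ w := by
            rw [map_mul, ← mulVec_mulVec, hpw, map_mul, mulVec_mulVec]
        _ = c a • w := by rw [hc, map_smul, smul_mulVec, hpw]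
        _ = _ := by simp
    rw [this, trace_vecMulVec, dotProduct_comm, hww]
  · apply Matrix.ext_of_mulVec_single
    intro i
    obtain ⟨a, ha⟩ := hcyc (Pi.single i 1)
    rw [← ha, zero_mulVec]
    nth_rewrite 1 [← hpw]
    rw [mulVec_mulVec, mulVec_mulVec, ← map_mul, ← map_mul, hq, map_zero, zero_mulVec]
  · obtain ⟨w', hw', hpw'⟩ := exists_unit_fixed_vector hpp φ hφ
    exact exists_isometric_intertwiner φ ρ.hom w w' hcyc fun a => by
      rw [hstate φ w' hw' hpw', hwc]

end MinimalProjections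

/-! ### Representation types, and the finite-dimensional case -/

section FinitelyTyped

open Matrix

theorem natCard_fiber {R : Type*} [Semiring R] {I J : Type*} [Fintype I] [DecidableEq J]
    (s : I → J) (j : J) :
    (Nat.card {i // s i = j} : R) = ∑ i, if s i = j then 1 else 0 := by
  rw [Nat.card_eq_fintype_card, Fintype.card_subtype, Finset.sum_boole]

/-- Up to small perturbations, the finite-dimensional representations of `A` are direct sums of
members of a finite list, with multiplicities that are almost determined by traces. -/
def FinitelyTyped (A : Type u) [CStarAlgebra A] : Prop :=
  ∀ F : Set A, F.Finite → ∀ ε > (0 : ℝ), ∀ κ > (0 : ℝ),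
    ∃ (J : Type) (_ : Fintype J) (ρ : J → FRep A) (h : J → A) (C : ℝ), 0 ≤ C ∧
      ∀ (m : ℕ) (φ : A →⋆ₐ[ℂ] Mat m), ∃ (φ' : A →⋆ₐ[ℂ] Mat m) (I : Type) (_ : Fintype I)
        (s : I → J), HasDecomp φ' (fun i => ρ (s i)) ∧ (∀ f ∈ F, ‖φ' f - φ f‖ ≤ ε) ∧
        ∑ j, (ρ j).dim * ‖(Nat.card {i // s i = j} : ℂ) - (φ (h j)).trace‖ ≤ κ * m + C

/-- No perturbation and no error are needed. Copies of the irreducibles are split off until nothing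
is left, and the trace of the minimal projection of one type is 1 on that type and 0 on the others.
-/
theorem FinitelyTyped.of_finiteDimensional (A : Type u) [CStarAlgebra A]
    [FiniteDimensional ℂ A] : FinitelyTyped A := by
  classical
  intro F _ ε hε κ hκ
  obtain ⟨T, hT, hTT, hT0⟩ := exists_inequivalent_minimalProjections (A := A)
  let J' := {p : T // ∃ (m : ℕ) (φ : A →⋆ₐ[ℂ] Mat m), φ p.1 ≠ 0}
  -- The index type of the list must lie in `Type`, whereas `J'` lives in the universe of `A`.
  let e : J' ≃ Fin (Fintype.card J') := Fintype.equivFin J'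
  have hex : ∀ p : J', _ := fun p =>
    (hT p.1.1 p.1.2).exists_rep p.2.choose_spec.choose p.2.choose_spec.choose_spec
  choose ρ hdim htr hzero hV using hex
  refine ⟨Fin (Fintype.card J'), inferInstance, fun j => ρ (e.symm j), fun j => (e.symm j).1.1, 0,
    le_rfl, fun m φ => ?_⟩
  have hdec : ∃ (I : Type) (_ : Fintype I) (s : I → Fin (Fintype.card J')),
      HasDecomp φ (fun i => ρ (e.symm (s i))) := by
    induction m using Nat.strong_induction_on with
    | _ m ih =>
      by_cases hm : m = 0
      · subst hm
        exact ⟨Empty, inferInstance, Empty.elim, hasDecomp_empty φ _⟩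
      obtain ⟨p, hp, hφp⟩ : ∃ p ∈ T, φ p ≠ 0 := by
        by_contra! h
        exact hm (hT0 φ h)
      let j : J' := ⟨⟨p, hp⟩, m, φ, hφp⟩
      obtain ⟨V, hVV, hVφ⟩ := hV j φ hφp
      obtain ⟨σ, hσ, hdec⟩ := exists_complement_rep φ (ρ j).hom V hVV hVφ
      obtain ⟨I, _, s, hs⟩ := ih σ.dim (by have := hdim j; omega) σ.hom
      refine ⟨Option I, inferInstance, fun o => o.elim (e j) s, ?_⟩
      convert hdec _ hs using 1
      ext1 o
      cases o <;> simp
  obtain ⟨I, _, s, hs⟩ := hdec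
  refine ⟨φ, I, inferInstance, s, hs, fun f _ => by simpa using hε.le, ?_⟩
  rw [Finset.sum_eq_zero fun j _ => ?_]
  · positivity
  rw [hs.trace, natCard_fiber]
  have : ∀ i, ((ρ (e.symm (s i))).hom (e.symm j).1.1).trace = if s i = j then (1 : ℂ) else 0 := by
    intro i
    split_ifs with hij
    · rw [hij, htr]
    · rw [hzero _ _ (hTT _ (e.symm j).1.2 _ (e.symm (s i)).1.2 _), trace_zero]
      intro h
      exact hij (e.symm.injective (Subtype.ext (Subtype.ext h))).symm
  rw [sub_eq_zero.2 (Finset.sum_congr rfl fun i _ => (this i).symm), norm_zero, mul_zero]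

end FinitelyTyped

/-! ### Point evaluations inside representations of a pullback -/

section CellPullback

open Matrix

/-- Evaluation at a point of a disk. -/
noncomputable def evalHom {n k : ℕ} (x : Disk n) : C(Disk n, Mat k) →⋆ₐ[ℂ] Mat k where
  toFun g := g x
  map_one' := rfl
  map_mul' _ _ := rfl
  map_zero' := rfl
  map_add' _ _ := rfl
  commutes' _ := rfl
  map_star' _ := rfl

@[simp]
theorem evalHom_apply {n k : ℕ} (x : Disk n) (g : C(Disk n, Mat k)) : evalHom x g = g x := rfl

/-- The joint eigenspaces of commuting Hermitian matrices span the whole space, so they cannot all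
lie in the kernel of the nonzero matrix `S i₀`. -/
theorem exists_joint_eigenvector {m : ℕ} {ι : Type*} (S : ι → Mat m)
    (hS : ∀ i, (S i).IsHermitian) (hcomm : ∀ i j, S i * S j = S j * S i) {i₀ : ι}
    (h0 : S i₀ ≠ 0) :
    ∃ (r : ι → ℝ) (w : Fin m → ℂ), w ≠ 0 ∧ (∀ i, S i *ᵥ w = (r i : ℂ) • w) ∧ r i₀ ≠ 0 := by
  have hsym : ∀ i, (toEuclideanLin (S i)).IsSymmetric := fun i =>
    isSymmetric_toEuclideanLin_iff.2 (hS i)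
  have htop := LinearMap.IsSymmetric.iSup_iInf_eq_top_of_commute hsym (fun i j _ => by
    change toEuclideanLin (S i) ∘ₗ toEuclideanLin (S j) =
      toEuclideanLin (S j) ∘ₗ toEuclideanLin (S i)
    rw [← toLpLin_mul_same, ← toLpLin_mul_same, hcomm])
  obtain ⟨χ, hχ⟩ : ∃ χ : ι → ℂ, ¬ (⨅ i, Module.End.eigenspace (toEuclideanLin (S i)) (χ i) ≤
      LinearMap.ker (toEuclideanLin (S i₀))) := by
    by_contra! h
    have h1 := iSup_le h
    rw [htop, top_le_iff, LinearMap.ker_eq_top] at h1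
    exact h0 ((map_eq_zero_iff _ toEuclideanLin.injective).1 h1)
  obtain ⟨w, hw, hw0⟩ := SetLike.not_le_iff_exists.1 hχ
  rw [Submodule.mem_iInf] at hw
  have hne : w ≠ 0 := by
    rintro rfl
    exact hw0 (Submodule.zero_mem _)
  have hreal : ∀ i, ((χ i).re : ℂ) = χ i := fun i =>
    Complex.conj_eq_iff_re.1 ((hsym i).conj_eigenvalue_eq_self
      (Module.End.hasEigenvalue_of_hasEigenvector ⟨hw i, hne⟩))
  have hw' : ∀ i, S i *ᵥ w.ofLp = ((χ i).re : ℂ) • w.ofLp := fun i => by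
    rw [hreal]
    exact congrArg WithLp.ofLp (Module.End.mem_eigenspace_iff.1 (hw i))
  refine ⟨fun i => (χ i).re, w.ofLp, by simpa using hne, hw', fun h => hw0 ?_⟩
  have h1 := hw' i₀
  rw [show (χ i₀).re = 0 from h, Complex.ofReal_zero, zero_smul] at h1
  exact congrArg (WithLp.toLp 2) h1

/-- Characters of `C(X, ℝ)` are point evaluations. -/
theorem exists_eq_eval {X : Type*} [TopologicalSpace X] [CompactSpace X] [T2Space X]
    (ν : C(X, ℝ) →ₐ[ℝ] ℝ) : ∃ x, ∀ f, ν f = f x := by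
  obtain ⟨x, hx⟩ := (WeakDual.CharacterSpace.continuousMapEval_bijective X ℝ).2
    (WeakDual.CharacterSpace.equivAlgHom.symm ν)
  refine ⟨x, fun f => ?_⟩
  rw [← WeakDual.CharacterSpace.continuousMapEval_apply_apply X ℝ x f, hx]
  rfl

/-- The image of `v` has norm `√‖v‖`, which tends to 0 at the origin. This allows a factor `√‖j‖` to
be pulled out of an element `j` of the kernel of `πB`. -/
theorem continuous_inv_sqrt_norm_smul (E : Type*) [NormedAddCommGroup E] [NormedSpace ℝ E] :
    Continuous fun v : E => (√‖v‖)⁻¹ • v := by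
  rw [continuous_iff_continuousAt]
  intro v
  by_cases hv : v = 0
  · subst hv
    have h : Filter.Tendsto (fun v : E => √‖v‖) (nhds 0) (nhds 0) := by
      have : Continuous fun v : E => √‖v‖ := by fun_prop
      simpa using this.tendsto 0
    rw [ContinuousAt, smul_zero]
    refine squeeze_zero_norm (fun v => ?_) h
    rw [norm_smul, norm_inv, Real.norm_of_nonneg (Real.sqrt_nonneg _)]
    have h1 := Real.mul_self_sqrt (norm_nonneg v)
    nth_rewrite 2 [← h1]
    by_cases h0 : √‖v‖ = 0
    · simp [h0]
    · rw [inv_mul_cancel_left₀ h0]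
  · have : √‖v‖ ≠ 0 := by
      rw [Real.sqrt_ne_zero (norm_nonneg v)]
      simpa using hv
    exact ContinuousAt.smul (ContinuousAt.inv₀ (by fun_prop) this) continuousAt_id

namespace IsCellPullback

variable {A B : Type u} [CStarAlgebra A] [CStarAlgebra B] {n k : ℕ}
  {φ : B →⋆ₐ[ℂ] C(DiskBoundary n, Mat k)} {πB : A →⋆ₐ[ℂ] B} {πD : A →⋆ₐ[ℂ] C(Disk n, Mat k)}

theorem ext (hA : IsCellPullback φ πB πD) {a a' : A} (h1 : πB a = πB a')
    (h2 : ∀ x, πD a x = πD a' x) : a = a' :=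
  (hA.existsUnique (πB a') (πD a') (hA.comm a')).unique ⟨h1, ContinuousMap.ext h2⟩ ⟨rfl, rfl⟩

theorem exists_of_boundary (hA : IsCellPullback φ πB πD) (b : B) (g : C(Disk n, Mat k))
    (h : ∀ (x : Disk n) (hx : ‖(x : EuclideanSpace ℝ (Fin n))‖ = 1),
      g x = φ b ⟨x, mem_sphere_zero_iff_norm.2 hx⟩) : ∃ a, πB a = b ∧ πD a = g := by
  refine (hA.existsUnique b g ?_).exists
  ext1 x
  exact (h ⟨x, Metric.sphere_subset_closedBall x.2⟩ (mem_sphere_zero_iff_norm.1 x.2)).symm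

theorem apply_boundary (hA : IsCellPullback φ πB πD) (a : A) (x : Disk n)
    (hx : ‖(x : EuclideanSpace ℝ (Fin n))‖ = 1) :
    πD a x = φ (πB a) ⟨x, mem_sphere_zero_iff_norm.2 hx⟩ := by
  rw [hA.comm]
  rfl

theorem exists_of_vanishing (hA : IsCellPullback φ πB πD) (g : C(Disk n, Mat k))
    (h : ∀ x : Disk n, ‖(x : EuclideanSpace ℝ (Fin n))‖ = 1 → g x = 0) :
    ∃ a, πB a = 0 ∧ πD a = g :=
  hA.exists_of_boundary 0 g fun x hx => by rw [h x hx, map_zero]; rfl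

theorem exists_extension (g : C(DiskBoundary n, Mat k)) :
    ∃ G : C(Disk n, Mat k), ∀ (x : Disk n) (hx : ‖(x : EuclideanSpace ℝ (Fin n))‖ = 1),
      G x = g ⟨x, mem_sphere_zero_iff_norm.2 hx⟩ := by
  have he : Topology.IsClosedEmbedding (Set.inclusion (Metric.sphere_subset_closedBall :
      Metric.sphere (0 : EuclideanSpace ℝ (Fin n)) 1 ⊆ Metric.closedBall 0 1)) :=
    Topology.IsClosedEmbedding.inclusion _ (Metric.isClosed_sphere.preimage continuous_subtype_val)
  obtain ⟨G, hG⟩ := ContinuousMap.exists_extension he g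
  refine ⟨G, fun x hx => ?_⟩
  rw [← hG]
  rfl

theorem surjective (hA : IsCellPullback φ πB πD) : Function.Surjective πB := by
  intro b
  obtain ⟨G, hG⟩ := exists_extension (φ b)
  obtain ⟨a, ha, -⟩ := hA.exists_of_boundary b G hG
  exact ⟨a, ha⟩

/-- A representation that does not vanish on the kernel of `πB` has a vector on which this kernel
acts through the evaluation at a point of the open cell. -/
theorem exists_eval_vector (hA : IsCellPullback φ πB πD) {m : ℕ}
    (Φ : A →⋆ₐ[ℂ] Mat m) {j : A} (hj : πB j = 0) (hΦ : Φ j ≠ 0) :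
    ∃ (x : Disk n) (w : Fin m → ℂ), w ≠ 0 ∧ ‖(x : EuclideanSpace ℝ (Fin n))‖ ≠ 1 ∧
      ∀ (a : A) (c : ℂ), πB a = 0 → πD a x = c • (1 : Mat k) → Φ a *ᵥ w = c • w := by
  -- Scalar functions vanishing on the sphere give the commuting self-adjoint central elements `z f`
  -- of `A`. A joint eigenvector of their images yields a character of this ideal.
  let T := ContinuousMap.idealOfSet ℝ {x : Disk n | ‖(x : EuclideanSpace ℝ (Fin n))‖ ≠ 1}
  have hT : ∀ {f : C(Disk n, ℝ)}, f ∈ T ↔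
      ∀ x : Disk n, ‖(x : EuclideanSpace ℝ (Fin n))‖ = 1 → f x = 0 := by
    intro f
    rw [ContinuousMap.mem_idealOfSet]
    simp
  choose z hzB hzD using fun f : T => hA.exists_of_vanishing
    ⟨fun x => (f.1 x : ℂ) • (1 : Mat k), by fun_prop⟩ fun x hx => by simp [hT.1 f.2 x hx]
  have hz : ∀ f x, πD (z f) x = (f.1 x : ℂ) • (1 : Mat k) := fun f x => by rw [hzD]; rfl
  have hcentral : ∀ f a, z f * a = a * z f := fun f a =>
    hA.ext (by simp [hzB]) fun x => by simp [hz]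
  have hzstar : ∀ f, star (z f) = z f := fun f =>
    hA.ext (by simp [hzB, map_star]) fun x => by simp [hz, map_star]
  -- every element of the kernel of `πB` factors through a central element
  have hfac : ∀ j : A, πB j = 0 → ∃ (f : T) (j' : A), j = j' * z f ∧ f.1 = fun x => √‖πD j x‖ := by
    intro j hj
    have hb : ∀ x : Disk n, ‖(x : EuclideanSpace ℝ (Fin n))‖ = 1 → πD j x = 0 := fun x hx => by
      rw [hA.apply_boundary j x hx, hj, map_zero]; rfl
    obtain ⟨j', hj'B, hj'D⟩ := hA.exists_of_vanishing
      ⟨fun x => (√‖πD j x‖)⁻¹ • πD j x,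
        (continuous_inv_sqrt_norm_smul (Mat k)).comp (πD j).continuous⟩
      fun x hx => by simp [hb x hx]
    let f : T := ⟨⟨fun x => √‖πD j x‖, by fun_prop⟩, hT.2 fun x hx => by simp [hb x hx]⟩
    refine ⟨f, j', hA.ext (by simp [hj, hj'B]) fun x => ?_, rfl⟩
    rw [map_mul, ContinuousMap.mul_apply, hz, hj'D]
    change πD j x = ((√‖πD j x‖)⁻¹ • πD j x) * (((√‖πD j x‖ : ℝ) : ℂ) • (1 : Mat k))
    by_cases h0 : πD j x = 0
    · simp [h0]
    have h1 : √‖πD j x‖ ≠ 0 := by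
      rw [Real.sqrt_ne_zero (norm_nonneg _)]
      simpa using h0
    rw [mul_smul_comm, mul_one, Complex.coe_smul, smul_smul, mul_inv_cancel₀ h1, one_smul]
  obtain ⟨g, j', hj', -⟩ := hfac j hj
  have hΦg : Φ (z g) ≠ 0 := fun h => hΦ (by rw [hj', map_mul, h, mul_zero])
  obtain ⟨χ, w, hw0, hw, hχg⟩ := exists_joint_eigenvector (fun f : T => Φ (z f))
    (fun f => by
      rw [IsHermitian, ← star_eq_conjTranspose, ← map_star, hzstar])
    (fun f f' => by rw [← map_mul, hcentral, map_mul]) hΦg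
  have hχ : ∀ (f : T) (r : ℝ), Φ (z f) *ᵥ w = (r : ℂ) • w → χ f = r := fun f r h => by
    rw [hw] at h
    exact_mod_cast smul_left_injective ℂ hw0 h
  have hadd : ∀ f f' : T, χ (f + f') = χ f + χ f' := fun f f' => by
    apply hχ
    rw [show z (f + f') = z f + z f' from hA.ext (by simp [hzB]) fun x => by
      simp [hz, add_smul], map_add, add_mulVec, hw, hw, Complex.ofReal_add, add_smul]
  have hsmul : ∀ (c : ℝ) (f : T), χ (c • f) = c * χ f := fun c f => by
    apply hχ
    rw [show z (c • f) = (c : ℂ) • z f from hA.ext (by rw [map_smul, hzB, hzB, smul_zero])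
      fun x => by
        rw [map_smul, ContinuousMap.smul_apply, hz, hz, smul_smul, ← Complex.ofReal_mul]; rfl,
      map_smul, smul_mulVec, hw, Complex.ofReal_mul, mul_smul]
  have hmul : ∀ f f' : T, χ ⟨f.1 * f'.1, T.mul_mem_left _ f'.2⟩ = χ f * χ f' := fun f f' => by
    apply hχ
    rw [show z ⟨f.1 * f'.1, T.mul_mem_left _ f'.2⟩ = z f * z f' from
      hA.ext (by simp [hzB]) fun x => by
        rw [map_mul, ContinuousMap.mul_apply, hz, hz, hz, smul_mul_smul_comm, one_mul,
          ← Complex.ofReal_mul]; rfl, map_mul, ← mulVec_mulVec, hw, mulVec_smul, hw, smul_smul, Complex.ofReal_mul, mul_comm]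
  -- The character `χ` of the ideal extends to the unital algebra `C(Disk n, ℝ)` by `h ↦ χ (h * g) /
  -- χ g`, and is therefore evaluation at a point.
  let N : C(Disk n, ℝ) → T := fun h => ⟨h * g.1, T.mul_mem_left _ g.2⟩
  have hN1 : N 1 = g := Subtype.ext (one_mul _)
  have hNmul : ∀ h h', χ (N (h * h')) * χ g = χ (N h) * χ (N h') := fun h h' => by
    rw [← hmul, ← hmul]
    congr 1
    exact Subtype.ext (by simp only [N]; ring)
  obtain ⟨x, hx⟩ := exists_eq_eval (AlgHom.ofLinearMap
    { toFun := fun h => χ (N h) / χ g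
      map_add' := fun h h' => by
        rw [← add_div, ← hadd]
        congr 2
        exact Subtype.ext (add_mul _ _ _)
      map_smul' := fun c h => by
        rw [RingHom.id_apply, smul_eq_mul, ← mul_div_assoc, ← hsmul]
        congr 2
        exact Subtype.ext (smul_mul_assoc _ _ _) }
    (by simp [hN1, hχg])
    (fun h h' => by
      simp only [LinearMap.coe_mk, AddHom.coe_mk]
      rw [div_mul_div_comm, ← hNmul, mul_div_mul_right _ _ hχg]))
  have hxχ : ∀ f : T, χ f = f.1 x := fun f => by
    have h1 : χ (N f.1) / χ g = f.1 x := hx f.1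
    have h2 : χ (N f.1) = χ f * χ g := hmul f g
    rwa [h2, mul_div_cancel_right₀ _ hχg] at h1
  have hgx : g.1 x ≠ 0 := by rwa [← hxχ]
  have hkill : ∀ a, πB a = 0 → πD a x = 0 → Φ a *ᵥ w = 0 := by
    intro a ha hax
    obtain ⟨f, a', haf, hf⟩ := hfac a ha
    have : f.1 x = 0 := by rw [hf]; simp [hax]
    rw [haf, map_mul, ← mulVec_mulVec, hw, hxχ, this]
    simp
  refine ⟨x, w, hw0, fun hx1 => hgx (hT.1 g.2 x hx1), fun a c ha hac => ?_⟩
  have hgx' : (g.1 x : ℂ) ≠ 0 := by exact_mod_cast hgx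
  have h := hkill (a - (c / (g.1 x : ℂ)) • z g)
    (by rw [map_sub, map_smul, hzB, ha, smul_zero, sub_zero])
    (by
      rw [map_sub, map_smul, ContinuousMap.sub_apply, ContinuousMap.smul_apply, hz, hac, smul_smul,
        div_mul_cancel₀ _ hgx', sub_self])
  rwa [map_sub, map_smul, sub_mulVec, smul_mulVec, hw, hxχ, smul_smul, div_mul_cancel₀ _ hgx',
    sub_eq_zero] at h

/-- A representation that does not vanish on the kernel of `πB` contains the evaluation at a point
of the cell. -/
theorem exists_eval_subrep (hA : IsCellPullback φ πB πD) (hk : 0 < k) {m : ℕ}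
    (Φ : A →⋆ₐ[ℂ] Mat m) {j : A} (hj : πB j = 0) (hΦ : Φ j ≠ 0) :
    ∃ (x : Disk n) (V : Matrix (Fin m) (Fin k) ℂ), Vᴴ * V = 1 ∧
      ∀ a, Φ a * V = V * πD a x := by
  obtain ⟨x, w, hw0, hx1, hw⟩ := hA.exists_eval_vector Φ hj hΦ
  have hx1' : 1 - ‖(x : EuclideanSpace ℝ (Fin n))‖ ≠ 0 := sub_ne_zero.2 hx1.symm
  -- The radial factor vanishes on the sphere and equals 1 at `x`, so every matrix is the value at
  -- `x` of an element of the kernel of `πB`.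
  choose t htB htD using fun c : Mat k => hA.exists_of_vanishing
    ⟨fun y => (((1 - ‖(y : EuclideanSpace ℝ (Fin n))‖) /
      (1 - ‖(x : EuclideanSpace ℝ (Fin n))‖) : ℝ) : ℂ) • c, by fun_prop⟩
    fun y hy => by simp [hy]
  have ht : ∀ c, πD (t c) x = c := fun c => by
    rw [htD, ContinuousMap.coe_mk, div_self hx1', Complex.ofReal_one, one_smul]
  have heq : ∀ a a', πB a = 0 → πB a' = 0 → πD a x = πD a' x → Φ a *ᵥ w = Φ a' *ᵥ w := by
    intro a a' h1 h2 h3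
    have := hw (a - a') 0 (by simp [h1, h2]) (by simp [h3])
    rwa [map_sub, sub_mulVec, zero_smul, sub_eq_zero] at this
  let o : Fin k := ⟨0, hk⟩
  obtain ⟨i, hi⟩ : ∃ i, star w ⬝ᵥ (Φ (t (single i i 1)) *ᵥ w) ≠ 0 := by
    by_contra! h
    have h1 : Φ (∑ i, t (single i i 1)) *ᵥ w = w := by
      have h2 := hw (∑ i, t (single i i 1)) 1
        (by rw [map_sum]; exact Finset.sum_eq_zero fun i _ => htB _)
        (by
          rw [map_sum, ContinuousMap.sum_apply, Finset.sum_congr rfl fun i _ => ht _,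
            Matrix.sum_single_one, one_smul])
      rwa [one_smul] at h2
    have h2 : star w ⬝ᵥ w = 0 := by
      nth_rewrite 2 [← h1]
      rw [map_sum, sum_mulVec, dotProduct_sum]
      exact Finset.sum_eq_zero fun i _ => h i
    exact hw0 (dotProduct_star_self_eq_zero.1 h2)
  -- Moving `w` by a matrix unit produces a vector whose functional is a positive multiple of the
  -- entry `(o, o)` at `x`. It matches the vector `μ e_o` of the evaluation representation.
  set w₁ := Φ (t (single o i 1)) *ᵥ w with hw₁
  have hst : ∀ a, star w₁ ⬝ᵥ (Φ a *ᵥ w₁) =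
      πD a x o o * (star w ⬝ᵥ (Φ (t (single i i 1)) *ᵥ w)) := by
    intro a
    have hval : πD (star (t (single o i 1)) * (a * t (single o i 1))) x =
        πD ((πD a x o o) • t (single i i 1)) x := by
      rw [map_mul, map_mul, map_smul, map_star, ContinuousMap.mul_apply, ContinuousMap.mul_apply,
        ContinuousMap.smul_apply, ContinuousMap.star_apply, ht, ht, star_eq_conjTranspose,
        conjTranspose_single, star_one, ← mul_assoc, single_mul_mul_single, smul_single]
      simp
    rw [hw₁, mulVec_mulVec, ← map_mul, star_mulVec_dotProduct_mulVec,
      heq _ ((πD a x o o) • t (single i i 1)) (by rw [map_mul, map_mul, htB, mul_zero, mul_zero])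
        (by rw [map_smul, htB, smul_zero]) hval, map_smul, smul_mulVec, dotProduct_smul,
      smul_eq_mul]
  have hμ : star w₁ ⬝ᵥ w₁ = ((‖WithLp.toLp 2 w₁‖ : ℝ) : ℂ) ^ 2 := by
    have h := inner_self_eq_norm_sq_to_K (𝕜 := ℂ) (WithLp.toLp 2 w₁)
    rw [EuclideanSpace.inner_eq_star_dotProduct, dotProduct_comm] at h
    exact h
  have h1 := hst 1
  rw [map_one, one_mulVec, hμ, map_one, ContinuousMap.one_apply, Matrix.one_apply_eq, one_mul]
    at h1
  set μ : ℂ := ((‖WithLp.toLp 2 w₁‖ : ℝ) : ℂ) with hμdef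
  have hμ0 : μ ≠ 0 := by
    intro h0
    rw [h0] at h1
    exact hi (by rw [← h1]; simp)
  obtain ⟨V, hVV, hV⟩ := exists_isometric_intertwiner Φ ((evalHom x).comp πD) (Pi.single o μ) w₁
    (fun v => ⟨t (of fun r _ => v r / μ), by
      rw [StarAlgHom.comp_apply, evalHom_apply, ht]
      ext r
      simp [hμ0]⟩)
    (fun a => by
      rw [hst, ← h1, StarAlgHom.comp_apply, evalHom_apply]
      have : star (Pi.single o μ : Fin k → ℂ) = Pi.single o μ := by
        rw [Pi.star_single]
        simp [hμdef]
      rw [this, mulVec_single, single_dotProduct]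
      simp
      ring)
  exact ⟨x, V, hVV, hV⟩

end IsCellPullback

end CellPullback

/-! ### Separating the base from the cell -/

section Regrouping

open Matrix

variable {A B : Type u} [CStarAlgebra A] [CStarAlgebra B]

/-- Used to expand the base part into its types while the cell evaluations stay untouched. -/
theorem HasDecomp.trans_left {m : ℕ} {φ : A →⋆ₐ[ℂ] Mat m} {I J : Type} [Fintype I] [Fintype J]
    {τ : FRep A} {α : I → FRep A} {β : J → FRep A}
    (h : HasDecomp φ (Sum.elim (fun _ : Unit => τ) β)) (hτ : HasDecomp τ.hom α) :
    HasDecomp φ (Sum.elim α β) := by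
  obtain ⟨V, hV, h⟩ := h
  obtain ⟨W, hW, hτ⟩ := hτ
  let V₀ : Matrix (Fin m) (Fin τ.dim) ℂ := V (.inl ())
  have h0 : V₀ᴴ * V₀ = 1 := hV.iso (.inl ())
  refine ⟨fun i => match i with
    | .inl i => V₀ * W i
    | .inr j => V (.inr j), ⟨?_, ?_, ?_⟩, fun a => ?_⟩
  · rintro (i | j)
    · change (V₀ * W i)ᴴ * (V₀ * W i) = 1
      rw [conjTranspose_mul, Matrix.mul_assoc, ← Matrix.mul_assoc V₀ᴴ, h0, Matrix.one_mul, hW.iso]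
    · exact hV.iso (.inr j)
  · rintro (i | j) (i' | j') hne
    · change (V₀ * W i)ᴴ * (V₀ * W i') = 0
      rw [conjTranspose_mul, Matrix.mul_assoc, ← Matrix.mul_assoc V₀ᴴ, h0, Matrix.one_mul,
        hW.orth i i' (by simpa using hne)]
    · change (V₀ * W i)ᴴ * V (.inr j') = 0
      rw [conjTranspose_mul, Matrix.mul_assoc,
        show V₀ᴴ * V (.inr j') = 0 from hV.orth (.inl ()) (.inr j') (by simp), Matrix.mul_zero]
    · change (V (.inr j))ᴴ * (V₀ * W i') = 0
      rw [← Matrix.mul_assoc, show (V (.inr j))ᴴ * V₀ = 0 from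
        hV.orth (.inr j) (.inl ()) (by simp), Matrix.zero_mul]
    · exact hV.orth (.inr j) (.inr j') (by simpa using hne)
  · rw [Fintype.sum_sum_type, ← hV.sum, Fintype.sum_sum_type]
    congr 1
    change ∑ i, V₀ * W i * (V₀ * W i)ᴴ = ∑ _ : Unit, V₀ * V₀ᴴ
    have h := congrArg (fun X => V₀ * (X * V₀ᴴ)) hW.sum
    simpa [Matrix.sum_mul, Matrix.mul_sum, Matrix.mul_assoc] using h
  · rw [h, Fintype.sum_sum_type, Fintype.sum_sum_type]
    congr 1
    change ∑ _ : Unit, V₀ * (τ.hom a * V₀ᴴ) = ∑ i, V₀ * W i * ((α i).hom a * (V₀ * W i)ᴴ)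
    rw [hτ, Matrix.sum_mul, Matrix.mul_sum]
    simp [Matrix.mul_assoc]

/-- Used to merge the base part with the points moved to the sphere into one representation of `B`.
-/
theorem HasDecomp.group_left {m : ℕ} {φ : A →⋆ₐ[ℂ] Mat m} {I J : Type} [Fintype I] [Fintype J]
    {τ : FRep A} {α : I → FRep A} {β : J → FRep A}
    (h : HasDecomp φ (Sum.elim α β)) (hτ : HasDecomp τ.hom α) :
    HasDecomp φ (Sum.elim (fun _ : Unit => τ) β) := by
  obtain ⟨V, hV, h⟩ := h
  obtain ⟨W, hW, hτ⟩ := hτ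
  let V₁ : ∀ i, Matrix (Fin m) (Fin (α i).dim) ℂ := fun i => V (.inl i)
  have key : ∀ i {l : ℕ} (T : ∀ i, Matrix (Fin (α i).dim) (Fin l) ℂ),
      (V₁ i)ᴴ * ∑ j, V₁ j * T j = T i := by
    intro i l T
    rw [Matrix.mul_sum, Finset.sum_eq_single i]
    · rw [← Matrix.mul_assoc, show (V₁ i)ᴴ * V₁ i = 1 from hV.iso (.inl i), Matrix.one_mul]
    · intro j _ hj
      rw [← Matrix.mul_assoc, show (V₁ i)ᴴ * V₁ j = 0 from
        hV.orth (.inl i) (.inl j) (by simpa using hj.symm), Matrix.zero_mul]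
    · simp
  let U : Matrix (Fin m) (Fin τ.dim) ℂ := ∑ i, V₁ i * (W i)ᴴ
  have hU : Uᴴ = ∑ i, W i * (V₁ i)ᴴ := by simp [U, conjTranspose_sum]
  have hUV : ∀ j, Uᴴ * V (.inr j) = 0 := fun j => by
    rw [hU, Matrix.sum_mul]
    refine Finset.sum_eq_zero fun i _ => ?_
    rw [Matrix.mul_assoc, show (V₁ i)ᴴ * V (.inr j) = 0 from hV.orth (.inl i) (.inr j) (by simp),
      Matrix.mul_zero]
  refine ⟨fun i => match i with
    | .inl _ => U
    | .inr j => V (.inr j), ⟨?_, ?_, ?_⟩, fun a => ?_⟩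
  · rintro (i | j)
    · change Uᴴ * U = 1
      rw [hU, Matrix.sum_mul, ← hW.sum]
      refine Finset.sum_congr rfl fun i _ => ?_
      rw [Matrix.mul_assoc, key i (fun i => (W i)ᴴ)]
    · exact hV.iso (.inr j)
  · rintro (i | j) (i' | j') hne
    · exact absurd rfl hne
    · exact hUV j'
    · change (V (.inr j))ᴴ * U = 0
      rw [← conjTranspose_conjTranspose U, ← conjTranspose_mul, hUV, conjTranspose_zero]
    · exact hV.orth (.inr j) (.inr j') (by simpa using hne)
  · rw [← hV.sum, Fintype.sum_sum_type, Fintype.sum_sum_type]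
    congr 1
    change ∑ _ : Unit, U * Uᴴ = ∑ i, V₁ i * (V₁ i)ᴴ
    rw [Finset.univ_unique, Finset.sum_singleton, hU]
    rw [show U = ∑ i, V₁ i * (W i)ᴴ from rfl, Matrix.sum_mul]
    refine Finset.sum_congr rfl fun i _ => ?_
    rw [Matrix.mul_assoc, hW.mul_sum i (fun i => (V₁ i)ᴴ)]
  · rw [h, Fintype.sum_sum_type, Fintype.sum_sum_type]
    congr 1
    change ∑ i, V₁ i * ((α i).hom a * (V₁ i)ᴴ) = ∑ _ : Unit, U * (τ.hom a * Uᴴ)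
    rw [Fintype.sum_unique (fun _ : Unit => U * (τ.hom a * Uᴴ)), hU, hτ, show U = ∑ i, V₁ i * (W i)ᴴ from rfl, Matrix.sum_mul,
      Matrix.sum_mul]
    refine Finset.sum_congr rfl fun i _ => ?_
    have h1 : ∀ i, W i * ((α i).hom a * (W i)ᴴ) * ∑ j, W j * (V₁ j)ᴴ =
        W i * ((α i).hom a * (V₁ i)ᴴ) := fun i => by
      rw [Matrix.mul_assoc, Matrix.mul_assoc, hW.mul_sum i (fun j => (V₁ j)ᴴ)]
    rw [Finset.sum_congr rfl fun i _ => h1 i, Matrix.mul_assoc,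
      hW.mul_sum i (fun i => (α i).hom a * (V₁ i)ᴴ)]

theorem exists_factor {π : A →⋆ₐ[ℂ] B} (hπ : Function.Surjective π) {m : ℕ}
    (φ : A →⋆ₐ[ℂ] Mat m) (hφ : ∀ a, π a = 0 → φ a = 0) :
    ∃ ψ : B →⋆ₐ[ℂ] Mat m, ψ.comp π = φ := by
  choose g hg using hπ
  have h : ∀ a b, π a = b → φ (g b) = φ a := fun a b hab => by
    rw [← sub_eq_zero, ← map_sub]
    exact hφ _ (by rw [map_sub, hg, hab, sub_self])
  exact ⟨{ toFun := fun b => φ (g b)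
           map_one' := by rw [h 1 1 (map_one _), map_one]
           map_mul' := fun x y => by rw [h (g x * g y) _ (by rw [map_mul, hg, hg]), map_mul]
           map_zero' := by rw [h 0 0 (map_zero _), map_zero]
           map_add' := fun x y => by rw [h (g x + g y) _ (by rw [map_add, hg, hg]), map_add]
           commutes' := fun r => by
             rw [h (algebraMap ℂ A r) _ (AlgHomClass.commutes π r), AlgHomClass.commutes φ r]
           map_star' := fun x => by
             rw [h (star (g x)) _ (by rw [map_star, hg]), map_star] },
    StarAlgHom.ext fun a => h a _ rfl⟩

/-- The evaluation representation at a point of a disk. -/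
noncomputable def evalRep {n k : ℕ} (πD : A →⋆ₐ[ℂ] C(Disk n, Mat k)) (x : Disk n) : FRep A :=
  ⟨k, (evalHom x).comp πD⟩

/-- A finite-dimensional representation of a pullback is the direct sum of a representation of the
base and of evaluations at points of the cell. -/
theorem IsCellPullback.exists_hasDecomp {n k : ℕ}
    {φ : B →⋆ₐ[ℂ] C(DiskBoundary n, Mat k)} {πB : A →⋆ₐ[ℂ] B} {πD : A →⋆ₐ[ℂ] C(Disk n, Mat k)}
    (hA : IsCellPullback φ πB πD) (hk : 0 < k) (m : ℕ) (Φ : A →⋆ₐ[ℂ] Mat m) :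
    ∃ (σ : FRep B) (P : Type) (_ : Fintype P) (x : P → Disk n),
      HasDecomp Φ (Sum.elim (fun _ : Unit => σ.comp πB) fun i => evalRep πD (x i)) := by
  induction m using Nat.strong_induction_on with
  | _ m ih =>
    by_cases hker : ∀ a, πB a = 0 → Φ a = 0
    · obtain ⟨ψ, rfl⟩ := exists_factor hA.surjective Φ hker
      refine ⟨⟨m, ψ⟩, Empty, inferInstance, Empty.elim, ?_⟩
      convert (hasDecomp_self (ψ.comp πB)).reindex (Equiv.sumEmpty Unit Empty) using 1
      ext1 i
      rcases i with i | i
      · rfl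
      · exact i.elim
    · push Not at hker
      obtain ⟨j, hj, hΦj⟩ := hker
      obtain ⟨x, V, hV, hΦV⟩ := hA.exists_eval_subrep hk Φ hj hΦj
      obtain ⟨σ', hσ', hdec⟩ := exists_complement_rep Φ ((evalHom x).comp πD) V hV hΦV
      obtain ⟨σ, P, _, y, hy⟩ := ih σ'.dim (by omega) σ'.hom
      let e : Unit ⊕ Option P ≃ Option (Unit ⊕ P) :=
        { toFun := Sum.elim (fun u => some (.inl u)) fun o => o.elim none fun p => some (.inr p)
          invFun := fun o => o.elim (.inr none) (Sum.elim .inl fun p => .inr (some p))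
          left_inv := by rintro (_ | _ | _) <;> rfl
          right_inv := by rintro (_ | _ | _) <;> rfl }
      refine ⟨σ, Option P, inferInstance, fun o => o.elim x y, ?_⟩
      convert (hdec _ hy).reindex e using 1
      ext1 i
      rcases i with i | _ | i <;> rfl

end Regrouping

/-! ### Rounding of fractional assignments -/

section Rounding

open Classical in
/-- Fractional assignments can be rounded so that all column sums change by at most the order of
the square root of the number of rows. -/
theorem exists_rounding {I T : Type} [Fintype I] [Fintype T] (w : I → T → ℝ)
    (hw0 : ∀ i t, 0 ≤ w i t) (hw1 : ∀ i, ∑ t, w i t = 1) :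
    ∃ s : I → T, (∀ i, 0 < w i (s i)) ∧
      ∑ t, (∑ i, ((if s i = t then 1 else 0) - w i t)) ^ 2 ≤ 2 * (Fintype.card I : ℝ) := by
  have hpos : ∀ i, ∃ t, 0 < w i t := fun i => by
    by_contra! h
    have := Finset.sum_nonpos fun t (_ : t ∈ Finset.univ) => h t
    rw [hw1] at this
    linarith
  choose s₀ hs₀ using hpos
  have key : ∀ S : Finset I, ∃ s : I → T, (∀ i, 0 < w i (s i)) ∧
      ∑ t, (∑ i ∈ S, ((if s i = t then 1 else 0) - w i t)) ^ 2 ≤ 2 * (S.card : ℝ) := by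
    intro S
    induction S using Finset.induction_on with
    | empty => exact ⟨s₀, hs₀, by simp⟩
    | insert a S ha ih =>
      obtain ⟨s, hs, hS⟩ := ih
      set E : T → ℝ := fun t => ∑ i ∈ S, ((if s i = t then 1 else 0) - w i t) with hE
      -- The new row goes to a column whose accumulated error is at most the average for the weights
      -- `w a`. The cross term of the squared error is then nonpositive, and the row itself adds at
      -- most 2.
      obtain ⟨t₀, ht₀, hEt⟩ : ∃ t₀, 0 < w a t₀ ∧ E t₀ ≤ ∑ t, w a t * E t := by
        by_contra! h
        have h1 : ∑ t, w a t * (∑ t, w a t * E t) < ∑ t, w a t * E t := by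
          refine Finset.sum_lt_sum (fun t _ => ?_) ⟨s₀ a, Finset.mem_univ _, ?_⟩
          · rcases (hw0 a t).eq_or_lt with h0 | h0
            · simp [← h0]
            · exact mul_le_mul_of_nonneg_left (h t h0).le h0.le
          · exact mul_lt_mul_of_pos_left (h _ (hs₀ a)) (hs₀ a)
        rw [← Finset.sum_mul, hw1, one_mul] at h1
        exact lt_irrefl _ h1
      refine ⟨Function.update s a t₀, fun i => ?_, ?_⟩
      · by_cases hi : i = a
        · subst hi; simpa using ht₀
        · simpa [hi] using hs i
      · have hsum : ∀ t, ∑ i ∈ insert a S,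
            ((if Function.update s a t₀ i = t then 1 else 0) - w i t) =
            E t + ((if t₀ = t then 1 else 0) - w a t) := by
          intro t
          rw [Finset.sum_insert ha, add_comm]
          congr 1
          · refine Finset.sum_congr rfl fun i hi => ?_
            rw [Function.update_of_ne (by rintro rfl; exact ha hi)]
          · simp
        have hw1' : ∀ t, w a t ≤ 1 := fun t => by
          rw [← hw1 a]
          exact Finset.single_le_sum (fun t _ => hw0 a t) (Finset.mem_univ t)
        have hcross : ∑ t, E t * ((if t₀ = t then 1 else 0) - w a t) ≤ 0 := by
          simp only [mul_sub, Finset.sum_sub_distrib, mul_ite, mul_one, mul_zero,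
            Finset.sum_ite_eq, Finset.mem_univ, if_true]
          simpa [mul_comm] using hEt
        have hsq : ∑ t, ((if t₀ = t then 1 else 0) - w a t) ^ 2 ≤ 2 := by
          have : ∀ t, ((if t₀ = t then (1 : ℝ) else 0) - w a t) ^ 2 ≤
              (if t₀ = t then 1 else 0) + w a t := fun t => by
            have h1 := hw0 a t
            have h2 := hw1' t
            split_ifs <;> nlinarith
          refine (Finset.sum_le_sum fun t _ => this t).trans ?_
          rw [Finset.sum_add_distrib, hw1]
          simp
          norm_num
        simp only [hsum, add_sq, Finset.sum_add_distrib, mul_assoc, ← Finset.mul_sum]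
        rw [Finset.card_insert_of_notMem ha]
        push_cast
        linarith
  obtain ⟨s, hs, h⟩ := key Finset.univ
  exact ⟨s, hs, by simpa using h⟩

open Classical in
theorem exists_rounding_linear {I T : Type} [Fintype I] [Fintype T] (w : I → T → ℝ)
    (hw0 : ∀ i t, 0 ≤ w i t) (hw1 : ∀ i, ∑ t, w i t = 1) {κ : ℝ} (hκ : 0 < κ) :
    ∃ s : I → T, (∀ i, 0 < w i (s i)) ∧
      ∀ t, |∑ i, ((if s i = t then 1 else 0) - w i t)| ≤ κ * Fintype.card I + 1 / (2 * κ) := by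
  obtain ⟨s, hs, h⟩ := exists_rounding w hw0 hw1
  refine ⟨s, hs, fun t => abs_le_of_sq_le_sq ?_ (by positivity)⟩
  refine (Finset.single_le_sum
    (f := fun t => (∑ i, ((if s i = t then (1 : ℝ) else 0) - w i t)) ^ 2)
    (fun t _ => sq_nonneg _) (Finset.mem_univ t)).trans (h.trans ?_)
  -- For `N` rows, `(κ N + 1/(2κ))² = (κ N - 1/(2κ))² + 2N`, which dominates the squared error `2N`.
  have h1 : κ * (1 / (2 * κ)) = 1 / 2 := by field_simp
  nlinarith [sq_nonneg (κ * Fintype.card I - 1 / (2 * κ))]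

open Classical in
theorem norm_rounding_sum_sub_le {I T : Type} [Fintype I] [Fintype T] (w : I → T → ℝ)
    (hw0 : ∀ i t, 0 ≤ w i t) (hw1 : ∀ i, ∑ t, w i t = 1) (s : I → T) {E : ℝ}
    (hs : ∀ t, |∑ i, ((if s i = t then 1 else 0) - w i t)| ≤ E) (q : T → Prop) (g : T → ℂ)
    {b : ℝ} (hb : ∀ t, ‖g t‖ ≤ b) (g' : I → ℂ) {κ : ℝ}
    (hg : ∀ i t, 0 < w i t → ‖g t - g' i‖ ≤ κ) :
    ‖∑ i, (if q (s i) then g (s i) else 0) -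
      ∑ i, ((∑ t, if q t then w i t else 0 : ℝ) : ℂ) * g' i‖ ≤
      Fintype.card T * (b * E) + Fintype.card I * κ := by
  -- The error splits into the discrepancy of column sums weighted by `g`, and the oscillation of
  -- `g` along the support of the weights.
  have h1 : ∑ i, (if q (s i) then g (s i) else 0) -
      ∑ i, ((∑ t, if q t then w i t else 0 : ℝ) : ℂ) * g' i =
      ∑ t, (if q t then g t else 0) * ((∑ i, ((if s i = t then 1 else 0) - w i t) : ℝ) : ℂ) +
      ∑ i, ∑ t, (w i t : ℂ) * (if q t then g t - g' i else 0) := by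
    have h2 : ∀ i, (if q (s i) then g (s i) else 0) =
        ∑ t, (if q t then g t else 0) * (if s i = t then 1 else 0) := fun i => by simp
    simp only [h2, Complex.ofReal_sum, Complex.ofReal_sub, Finset.mul_sum, Finset.sum_mul]
    rw [Finset.sum_comm (s := (Finset.univ : Finset T)), ← Finset.sum_sub_distrib,
      ← Finset.sum_add_distrib]
    refine Finset.sum_congr rfl fun i _ => ?_
    rw [← Finset.sum_sub_distrib, ← Finset.sum_add_distrib]
    refine Finset.sum_congr rfl fun t _ => ?_
    split_ifs <;> push_cast <;> ring
  rw [h1]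
  refine (norm_add_le _ _).trans (add_le_add ?_ ?_)
  · refine (norm_sum_le _ _).trans ?_
    rw [← nsmul_eq_mul, ← Finset.card_univ, ← Finset.sum_const]
    refine Finset.sum_le_sum fun t _ => ?_
    rw [norm_mul, Complex.norm_real, Real.norm_eq_abs]
    refine mul_le_mul ?_ (hs t) (abs_nonneg _) ((norm_nonneg _).trans (hb t))
    split_ifs
    · exact hb t
    · simpa using (norm_nonneg _).trans (hb t)
  · refine (norm_sum_le _ _).trans ?_
    rw [← nsmul_eq_mul, ← Finset.card_univ, ← Finset.sum_const]
    refine Finset.sum_le_sum fun i _ => ?_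
    refine (norm_sum_le _ _).trans ?_
    rw [← one_mul κ, ← hw1 i, Finset.sum_mul]
    refine Finset.sum_le_sum fun t _ => ?_
    rw [norm_mul, Complex.norm_real, Real.norm_of_nonneg (hw0 i t)]
    rcases (hw0 i t).eq_or_lt with h0 | h0
    · simp [← h0]
    refine mul_le_mul_of_nonneg_left ?_ h0.le
    have := hg i t h0
    split_ifs
    · exact this
    · simpa using (norm_nonneg _).trans this

/-- A fine partition of unity on a compact metric space, with base points that lie in `Y` for those
members that do not vanish on `Y`. -/
theorem exists_adapted_partition {X : Type} [MetricSpace X] [CompactSpace X] (Y : Set X) {δ : ℝ}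
    (hδ : 0 < δ) :
    ∃ (T : Type) (_ : Fintype T) (p : T → X) (f : T → C(X, ℝ)), (∀ t x, 0 ≤ f t x) ∧
      (∀ x, ∑ t, f t x = 1) ∧ (∀ t x, 0 < f t x → dist x (p t) < δ) ∧
      ∀ t, p t ∉ Y → ∀ y ∈ Y, f t y = 0 := by
  classical
  obtain ⟨S, -, hSfin, hS⟩ := finite_cover_balls_of_compact (isCompact_univ (X := X))
    (half_pos hδ)
  lift S to Finset X using hSfin
  -- Tents of radius `δ / 2` leave room to move the base point into `Y` whenever the tent meets `Y`;
  -- the distances stay below `δ`.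
  let u : S → C(X, ℝ) := fun c => ⟨fun x => max 0 (δ / 2 - dist x c), by fun_prop⟩
  have hu0 : ∀ c x, 0 ≤ u c x := fun c x => le_max_left _ _
  have hupos : ∀ x, 0 < ∑ c, u c x := fun x => by
    have hx := hS (Set.mem_univ x)
    simp only [Set.mem_iUnion, Metric.mem_ball] at hx
    obtain ⟨c, hc, hxc⟩ := hx
    refine Finset.sum_pos' (fun c _ => hu0 c x) ⟨⟨c, hc⟩, Finset.mem_univ _, ?_⟩
    exact lt_max_of_lt_right (by simpa using hxc)
  have hudist : ∀ c x, 0 < u c x → dist x c < δ / 2 := fun c x h => by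
    rcases lt_max_iff.1 h with h | h
    · exact absurd h (lt_irrefl _)
    · linarith
  let f : S → C(X, ℝ) := fun c => ⟨fun x => u c x / ∑ c, u c x,
    (u c).continuous.div (by fun_prop) fun x => (hupos x).ne'⟩
  have hfu : ∀ c x, f c x ≠ 0 → dist x c < δ / 2 := fun c x h => by
    refine hudist c x ((hu0 c x).lt_of_ne' fun h0 => h ?_)
    change u c x / _ = 0
    rw [h0, zero_div]
  have hp : ∀ c : S, ∃ p : X, (∀ x, 0 < f c x → dist x p < δ) ∧
      (p ∉ Y → ∀ y ∈ Y, f c y = 0) := by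
    intro c
    by_cases h : ∃ y ∈ Y, f c y ≠ 0
    · obtain ⟨y, hy, hfy⟩ := h
      refine ⟨y, fun x hx => ?_, fun h => absurd hy h⟩
      have h1 := hfu c x hx.ne'
      have h2 := hfu c y hfy
      rw [dist_comm] at h2
      linarith [dist_triangle x c y]
    · push Not at h
      exact ⟨c, fun x hx => by linarith [hfu c x hx.ne'], fun _ => h⟩
  choose p hp1 hp2 using hp
  refine ⟨S, inferInstance, p, f, fun c x => div_nonneg (hu0 c x) (hupos x).le, fun x => ?_,
    hp1, hp2⟩
  change ∑ c, u c x / ∑ c, u c x = 1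
  rw [← Finset.sum_div, div_self (hupos x).ne']

end Rounding

/-! ### The induction step: attaching a cell -/

section AttachCell

open Matrix

variable {A B : Type u} [CStarAlgebra A] [CStarAlgebra B]

/-- The representation of the base given by a point of the boundary sphere. -/
noncomputable def boundaryRep {n k : ℕ} (φ : B →⋆ₐ[ℂ] C(DiskBoundary n, Mat k))
    (y : DiskBoundary n) : FRep B :=
  ⟨k, { toFun := fun b => φ b y
        map_one' := by rw [map_one]; rfl
        map_mul' := fun a b => by rw [map_mul]; rfl
        map_zero' := by rw [map_zero]; rfl
        map_add' := fun a b => by rw [map_add]; rfl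
        commutes' := fun r => by rw [AlgHomClass.commutes]; rfl
        map_star' := fun b => by rw [map_star]; rfl }⟩

theorem IsCellPullback.evalRep_eq_comp {n k : ℕ}
    {φ : B →⋆ₐ[ℂ] C(DiskBoundary n, Mat k)} {πB : A →⋆ₐ[ℂ] B} {πD : A →⋆ₐ[ℂ] C(Disk n, Mat k)}
    (hA : IsCellPullback φ πB πD) (x : Disk n) (hx : ‖(x : EuclideanSpace ℝ (Fin n))‖ = 1) :
    evalRep πD x = (boundaryRep φ ⟨x, mem_sphere_zero_iff_norm.2 hx⟩).comp πB := by
  rw [evalRep, FRep.comp]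
  congr 1
  exact StarAlgHom.ext fun a => hA.apply_boundary a x hx

theorem exists_uniform_delta {X E ι : Type*} [MetricSpace X] [CompactSpace X]
    [PseudoMetricSpace E] {F : Set ι} (hF : F.Finite) (g : ι → C(X, E)) {ε : ℝ} (hε : 0 < ε) :
    ∃ δ > 0, ∀ f ∈ F, ∀ x y, dist x y < δ → dist (g f x) (g f y) < ε := by
  have h : ∀ᶠ p : X × X in uniformity X, ∀ f ∈ F, dist (g f p.1) (g f p.2) < ε :=
    (Filter.eventually_all_finite hF).2 fun f _ =>
      (CompactSpace.uniformContinuous_of_continuous (g f).continuous)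
        (Metric.dist_mem_uniformity hε)
  obtain ⟨δ, hδ, h⟩ := Metric.mem_uniformity_dist.1 h
  exact ⟨δ, hδ, fun f hf x y hxy => h hxy f hf⟩

-- Each cell point is moved to a nearby base point chosen by rounding. Base points on the sphere
-- factor through `B`, so those summands join the base part before the hypothesis on `B` is applied;
-- interior base points become new types. The trace of a test element sees fractional weights, and
-- the rounding bound compares these with the actual counts.
open Classical in
theorem FinitelyTyped.of_cellPullback {n k : ℕ}
    {φ : B →⋆ₐ[ℂ] C(DiskBoundary n, Mat k)} {πB : A →⋆ₐ[ℂ] B} {πD : A →⋆ₐ[ℂ] C(Disk n, Mat k)}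
    (hA : IsCellPullback φ πB πD) (hk : 0 < k) (hB : FinitelyTyped B) : FinitelyTyped A := by
  intro F hF ε hε κ hκ
  obtain ⟨J, _, ρ, h, C, hC, hρ⟩ := hB (πB '' F) (hF.image _) (ε / 2) (half_pos hε) (κ / 3)
    (by positivity)
  choose hl hhl using fun j => hA.surjective (h j)
  let g : J → C(Disk n, ℂ) := fun j => ⟨fun x => (πD (hl j) x).trace, by fun_prop⟩
  set D : ℝ := ∑ j, ((ρ j).dim : ℝ) with hD
  have hD0 : 0 ≤ D := by positivity
  -- The budget `κ` is shared equally by the hypothesis on `B`, the oscillation of the trace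
  -- functions (`κ₂`) and the rounding error (`κ₁`).
  set κ₂ : ℝ := κ / (3 * (D + 1)) with hκ₂
  have hκ₂0 : 0 < κ₂ := by positivity
  have hκ₂' : (D + 1) * κ₂ = κ / 3 := by
    rw [hκ₂]; field_simp
  obtain ⟨δ₁, hδ₁, hF₁⟩ := exists_uniform_delta hF (fun f => πD f) (half_pos hε)
  obtain ⟨δ₂, hδ₂, hg₂⟩ := exists_uniform_delta (Set.finite_univ (α := J)) g hκ₂0
  let Y : Set (Disk n) := {x | ‖(x : EuclideanSpace ℝ (Fin n))‖ = 1}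
  obtain ⟨T, _, p, f, hf0, hf1, hfp, hfY⟩ := exists_adapted_partition Y (lt_min hδ₁ hδ₂)
  obtain ⟨b, hb0, hb⟩ : ∃ b : ℝ, 0 ≤ b ∧ ∀ j x, ‖g j x‖ ≤ b :=
    ⟨∑ j, ‖g j‖, by positivity, fun j x => ((g j).norm_coe_le_norm x).trans
      (Finset.single_le_sum (f := fun j => ‖g j‖) (fun _ _ => norm_nonneg _)
        (Finset.mem_univ j))⟩
  -- lifts of the test elements of the base, and test elements of the cell
  choose hb' hb'B hb'D using fun j => hA.exists_of_boundary (h j)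
    ⟨fun x => ((∑ t, if p t ∈ Y then f t x else 0 : ℝ) : ℂ) • πD (hl j) x, by
      have : ∀ t, Continuous fun x => if p t ∈ Y then f t x else 0 := fun t => by
        split_ifs <;> fun_prop
      fun_prop⟩
    (fun x hx => by
      -- On the sphere the members with interior base point vanish, so the truncated sum is 1 and
      -- the cutoff of the lift still has boundary value `φ (h j)`.
      have : ∑ t, (if p t ∈ Y then f t x else 0) = 1 := by
        refine (Finset.sum_congr rfl fun t _ => ?_).trans (hf1 x)
        split_ifs with ht
        · rfl
        · exact (hfY t ht x hx).symm
      rw [ContinuousMap.coe_mk, this, Complex.ofReal_one, one_smul, ← hhl]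
      exact hA.apply_boundary (hl j) x hx)
  -- Division by `k` makes the trace at a point `x` equal to `f t x`, the fractional weight itself.
  choose hc hcB hcD using fun t : {t // p t ∉ Y} => hA.exists_of_vanishing
    ⟨fun x => ((f t.1 x / k : ℝ) : ℂ) • (1 : Mat k), by fun_prop⟩
    (fun x hx => by simp [hfY t.1 t.2 x hx])
  -- `W` is the total factor with which the rounding error `E` enters: the first term from the types
  -- of `B`, the second from the new types.
  set W : ℝ := D * (Fintype.card T * b) + Fintype.card T * k with hW
  have hW0 : 0 ≤ W := by positivity
  set κ₁ : ℝ := κ / (3 * (W + 1)) with hκ₁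
  have hκ₁0 : 0 < κ₁ := by positivity
  have hκ₁' : (W + 1) * κ₁ = κ / 3 := by
    rw [hκ₁]; field_simp
  refine ⟨J ⊕ {t // p t ∉ Y}, inferInstance,
    Sum.elim (fun j => (ρ j).comp πB) (fun t => evalRep πD (p t.1)), Sum.elim hb' hc,
    C + W * (1 / (2 * κ₁)), by positivity, fun m Φ => ?_⟩
  obtain ⟨σ, P, _, x, hdec⟩ := hA.exists_hasDecomp hk m Φ
  obtain ⟨s, hs0, hs⟩ := exists_rounding_linear (fun i t => f t (x i)) (fun i t => hf0 t (x i))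
    (fun i => hf1 (x i)) hκ₁0
  have hPm : (Fintype.card P : ℝ) ≤ m := by
    have h1 := hdec.sum_dim
    rw [Fintype.sum_sum_type] at h1
    have h2 : ∑ i : P, (evalRep πD (x i)).dim = Fintype.card P * k := by
      simp [evalRep]
    simp only [Sum.elim_inr, h2] at h1
    have h3 : Fintype.card P * 1 ≤ Fintype.card P * k := Nat.mul_le_mul_left _ hk
    exact_mod_cast (by omega : Fintype.card P ≤ m)
  have hself : ∀ {l : ℕ} (M : Mat l), ‖M - M‖ ≤ ε / 2 := fun M => by
    simpa using (half_pos hε).le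
  -- move the points of the cell to the base points of the partition
  obtain ⟨Φ₁, hΦ₁, hΦ₁F⟩ := hdec.perturb
    (Sum.elim (fun _ => σ.comp πB) fun i => evalRep πD (p (s i))) F (half_pos hε).le (by
      rintro (i | i)
      · exact ⟨_, rfl, fun f _ => hself _⟩
      · refine ⟨_, rfl, fun a ha => ?_⟩
        have h1 := hF₁ a ha (p (s i)) (x i) (by
          rw [dist_comm]
          exact (hfp _ _ (hs0 i)).trans_le (min_le_left _ _))
        rw [dist_eq_norm] at h1
        exact h1.le)
  let P₁ := {i // p (s i) ∈ Y}
  let P₂ := {i // p (s i) ∉ Y}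
  let β : P₂ → FRep A := fun i => evalRep πD (p (s i.1))
  let α : Unit ⊕ P₁ → FRep B := Sum.elim (fun _ => σ)
    fun i => boundaryRep φ ⟨p (s i.1), mem_sphere_zero_iff_norm.2 i.2⟩
  obtain ⟨τ, hτ⟩ := FRep.exists_sum α
  have hΦ₁' : HasDecomp Φ₁ (Sum.elim (fun _ : Unit => τ.comp πB) β) := by
    refine HasDecomp.group_left (α := fun i => (α i).comp πB) ?_ (hτ.comp πB)
    let e : (Unit ⊕ P₁) ⊕ P₂ ≃ Unit ⊕ P := (Equiv.sumAssoc Unit P₁ P₂).trans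
      (Equiv.sumCongr (Equiv.refl _) (Equiv.sumCompl fun i => p (s i) ∈ Y))
    convert hΦ₁.reindex e using 1
    ext1 i
    rcases i with (i | i) | i
    · rfl
    · exact (hA.evalRep_eq_comp (p (s i.1)) i.2).symm
    · rfl
  obtain ⟨τ', I, _, s', hτ', hτ'F, hτ'tr⟩ := hρ τ.dim τ.hom
  obtain ⟨Φ₂, hΦ₂, hΦ₂F⟩ := hΦ₁'.perturb
    (Sum.elim (fun _ => FRep.comp ⟨τ.dim, τ'⟩ πB) β) F (half_pos hε).le (by
      rintro (i | i)
      · exact ⟨_, rfl, fun f hf => hτ'F (πB f) ⟨f, hf, rfl⟩⟩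
      · exact ⟨_, rfl, fun f _ => hself _⟩)
  have hτm : (τ.dim : ℝ) ≤ m := by
    have h1 := hΦ₁'.sum_dim
    rw [Fintype.sum_sum_type] at h1
    simp only [Sum.elim_inl, Fintype.sum_unique] at h1
    change τ.dim + _ = m at h1
    exact_mod_cast (by omega : τ.dim ≤ m)
  refine ⟨Φ₂, I ⊕ P₂, inferInstance, Sum.map s' fun i => ⟨s i.1, i.2⟩, ?_, fun a ha => ?_, ?_⟩
  · convert hΦ₂.trans_left (hτ'.comp πB) using 1
    ext1 i
    rcases i with i | i <;> rfl
  · calc ‖Φ₂ a - Φ a‖ = ‖(Φ₂ a - Φ₁ a) + (Φ₁ a - Φ a)‖ := by rw [sub_add_sub_cancel]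
      _ ≤ ε / 2 + ε / 2 := (norm_add_le _ _).trans (add_le_add (hΦ₂F a ha) (hΦ₁F a ha))
      _ = ε := add_halves ε
  set E : ℝ := κ₁ * Fintype.card P + 1 / (2 * κ₁) with hE
  have hE0 : 0 ≤ E := by positivity
  have hbase : ∀ j, ‖(Nat.card {i : I ⊕ P₂ // Sum.map s'
      (fun i => (⟨s i.1, i.2⟩ : {t // p t ∉ Y})) i = Sum.inl j} : ℂ) - (Φ (hb' j)).trace‖ ≤
      ‖(Nat.card {i // s' i = j} : ℂ) - (τ.hom (h j)).trace‖ +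
        (Fintype.card T * (b * E) + Fintype.card P * κ₂) := by
    intro j
    have hτtr : (τ.hom (h j)).trace = (σ.hom (h j)).trace +
        ∑ i, (if p (s i) ∈ Y then g j (p (s i)) else 0) := by
      rw [hτ.trace, Fintype.sum_sum_type, ← Finset.sum_filter, ← Finset.sum_subtype_eq_sum_filter,
        Finset.subtype_univ]
      simp only [Fintype.sum_unique]
      congr 1
      refine Finset.sum_congr rfl fun i _ => ?_
      change (φ (h j) _).trace = (πD (hl j) _).trace
      rw [hA.apply_boundary (hl j) _ i.2, hhl]
    have hΦtr : (Φ (hb' j)).trace = (σ.hom (h j)).trace +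
        ∑ i, ((∑ t, if p t ∈ Y then f t (x i) else 0 : ℝ) : ℂ) * g j (x i) := by
      rw [hdec.trace, Fintype.sum_sum_type]
      simp only [Fintype.sum_unique]
      congr 1
      · change (σ.hom (πB (hb' j))).trace = _
        rw [hb'B]
      · refine Finset.sum_congr rfl fun i _ => ?_
        change (πD (hb' j) (x i)).trace = _
        rw [hb'D, ContinuousMap.coe_mk, trace_smul, smul_eq_mul]
        rfl
    have hcount : (Nat.card {i : I ⊕ P₂ // Sum.map s'
        (fun i => (⟨s i.1, i.2⟩ : {t // p t ∉ Y})) i = Sum.inl j} : ℂ) =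
        Nat.card {i // s' i = j} := by
      rw [natCard_fiber, natCard_fiber, Fintype.sum_sum_type]
      simp only [Sum.map_inl, Sum.map_inr, Sum.inl.injEq, reduceCtorEq, if_false,
        Finset.sum_const_zero, add_zero]
    rw [hcount]
    have h2 := norm_rounding_sum_sub_le (fun i t => f t (x i)) (fun i t => hf0 t (x i))
      (fun i => hf1 (x i)) s hs (fun t => p t ∈ Y) (fun t => g j (p t)) (fun t => hb j (p t))
      (fun i => g j (x i)) (κ := κ₂) (fun i t hit => by
        rw [← dist_eq_norm, dist_comm]
        exact (hg₂ j (Set.mem_univ _) _ _ ((hfp _ _ hit).trans_le (min_le_right _ _))).le)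
    have h3 : (Nat.card {i // s' i = j} : ℂ) - (Φ (hb' j)).trace =
        ((Nat.card {i // s' i = j} : ℂ) - (τ.hom (h j)).trace) +
        (∑ i, (if p (s i) ∈ Y then g j (p (s i)) else 0) -
          ∑ i, ((∑ t, if p t ∈ Y then f t (x i) else 0 : ℝ) : ℂ) * g j (x i)) := by
      rw [hτtr, hΦtr]; ring
    rw [h3]
    exact (norm_add_le _ _).trans (add_le_add le_rfl h2)
  have hcell : ∀ t, ‖(Nat.card {i : I ⊕ P₂ // Sum.map s'
      (fun i => (⟨s i.1, i.2⟩ : {t // p t ∉ Y})) i = Sum.inr t} : ℂ) - (Φ (hc t)).trace‖ ≤ E := by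
    intro t
    have hcount : (Nat.card {i : I ⊕ P₂ // Sum.map s'
        (fun i => (⟨s i.1, i.2⟩ : {t // p t ∉ Y})) i = Sum.inr t} : ℂ) =
        ∑ i, if s i = t.1 then 1 else 0 := by
      rw [natCard_fiber, Fintype.sum_sum_type,
        ← Fintype.sum_subtype_add_sum_subtype (fun i => p (s i) ∈ Y)]
      simp only [Sum.map_inl, Sum.map_inr, reduceCtorEq, if_false, Finset.sum_const_zero,
        Sum.inr.injEq, Subtype.ext_iff]
      congr 1
      refine (Finset.sum_eq_zero fun i _ => if_neg fun h => t.2 ?_).symm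
      rw [← h]
      exact i.2
    have hΦtr : (Φ (hc t)).trace = ∑ i, (f t.1 (x i) : ℂ) := by
      rw [hdec.trace, Fintype.sum_sum_type]
      simp only [Fintype.sum_unique]
      have h1 : ((σ.comp πB).hom (hc t)).trace = 0 := by
        change (σ.hom (πB (hc t))).trace = 0
        rw [hcB, map_zero, trace_zero]
      refine (congrArg₂ (· + ·) h1 (Finset.sum_congr rfl fun i _ => ?_)).trans (zero_add _)
      change (πD (hc t) (x i)).trace = _
      have hk0 : (k : ℂ) ≠ 0 := by exact_mod_cast hk.ne'
      rw [hcD, ContinuousMap.coe_mk, trace_smul, trace_one, Fintype.card_fin, smul_eq_mul]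
      push_cast
      field_simp
    rw [hcount, hΦtr, ← Finset.sum_sub_distrib]
    have h1 := hs t.1
    have h2 : ∑ i, ((if s i = t.1 then (1 : ℂ) else 0) - (f t.1 (x i) : ℂ)) =
        ((∑ i, ((if s i = t.1 then (1 : ℝ) else 0) - f t.1 (x i)) : ℝ) : ℂ) := by
      rw [Complex.ofReal_sum]
      refine Finset.sum_congr rfl fun i _ => ?_
      split_ifs <;> push_cast <;> rfl
    rw [h2, Complex.norm_real, Real.norm_eq_abs]
    exact h1
  rw [Fintype.sum_sum_type]
  have hsum1 : ∑ j, ((ρ j).dim : ℝ) * ‖(Nat.card {i : I ⊕ P₂ // Sum.map s'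
      (fun i => (⟨s i.1, i.2⟩ : {t // p t ∉ Y})) i = Sum.inl j} : ℂ) - (Φ (hb' j)).trace‖ ≤
      κ / 3 * τ.dim + C + D * (Fintype.card T * (b * E) + Fintype.card P * κ₂) := by
    refine (Finset.sum_le_sum fun j _ => mul_le_mul_of_nonneg_left (hbase j)
      (Nat.cast_nonneg _)).trans ?_
    simp only [mul_add ((ρ _).dim : ℝ) ‖_‖, Finset.sum_add_distrib, ← Finset.sum_mul]
    exact add_le_add hτ'tr le_rfl
  have hsum2 : ∑ t : {t // p t ∉ Y}, (k : ℝ) * ‖(Nat.card {i : I ⊕ P₂ // Sum.map s'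
      (fun i => (⟨s i.1, i.2⟩ : {t // p t ∉ Y})) i = Sum.inr t} : ℂ) - (Φ (hc t)).trace‖ ≤
      Fintype.card T * (k * E) := by
    refine (Finset.sum_le_sum fun t _ => mul_le_mul_of_nonneg_left (hcell t)
      (Nat.cast_nonneg k)).trans ?_
    rw [Finset.sum_const, nsmul_eq_mul, Finset.card_univ]
    exact mul_le_mul_of_nonneg_right (by exact_mod_cast Fintype.card_subtype_le _) (by positivity)
  refine (add_le_add hsum1 hsum2).trans ?_
  have h1 : κ / 3 * τ.dim ≤ κ / 3 * m := mul_le_mul_of_nonneg_left hτm (by positivity)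
  have h2 : (D * κ₂) * Fintype.card P ≤ κ / 3 * m :=
    mul_le_mul (by linarith) hPm (Nat.cast_nonneg _) (by positivity)
  have h3 : (W * κ₁) * Fintype.card P ≤ κ / 3 * m :=
    mul_le_mul (by linarith) hPm (Nat.cast_nonneg _) (by positivity)
  have h4 : D * (Fintype.card T * (b * E) + Fintype.card P * κ₂) + Fintype.card T * (k * E) =
      W * κ₁ * Fintype.card P + W * (1 / (2 * κ₁)) + D * κ₂ * Fintype.card P := by
    rw [hW, hE]; ring
  linarith

end AttachCell

/-! ### Induction over cells, and many orthogonal elements -/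

section NCCC

open Matrix

theorem IsNCCC.finitelyTyped {A : Type u} [CStarAlgebra A] (hA : IsNCCC A) : FinitelyTyped A := by
  induction hA with
  | finiteDimensional A hA => exact FinitelyTyped.of_finiteDimensional A
  | attachCell A B hB n k hk φ πB πD hA ih => exact FinitelyTyped.of_cellPullback hA hk ih

/-- There are arbitrarily many pairwise orthogonal positive elements that are detected by
finite-dimensional representations. -/
def HasManyOrthogonals (A : Type u) [CStarAlgebra A] : Prop :=
  ∀ L : ℕ, ∃ b : Fin L → A, (∀ i j, i ≠ j → b i * star (b j) = 0) ∧
    ∀ i, ∃ (m : ℕ) (φ : A →⋆ₐ[ℂ] Mat m), φ (star (b i) * b i) ≠ 0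

variable {A B : Type u} [CStarAlgebra A] [CStarAlgebra B]

theorem HasManyOrthogonals.of_cellPullback {n k : ℕ} (hn : n ≠ 0)
    {φ : B →⋆ₐ[ℂ] C(DiskBoundary n, Mat k)} {πB : A →⋆ₐ[ℂ] B} {πD : A →⋆ₐ[ℂ] C(Disk n, Mat k)}
    (hA : IsCellPullback φ πB πD) (hk : 0 < k) : HasManyOrthogonals A := by
  intro L
  have hL : (0 : ℝ) < L + 1 := by positivity
  -- The bumps live on disjoint spherical shells of half-width `r` around the radii `(i + 1) / (L +
  -- 1)`, all away from the boundary sphere.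
  let r : ℝ := 1 / (2 * (L + 1))
  have hr : 0 < r := by positivity
  have h2r : 2 * r * (L + 1) = 1 := by simp only [r]; field_simp
  let c : Fin L → ℝ := fun i => 2 * r * (i + 1)
  have hc0 : ∀ i, 0 ≤ c i := fun i => by positivity
  have hc1 : ∀ i, c i + 2 * r ≤ 1 := fun i => by
    have h1 : ((i : ℕ) : ℝ) + 1 ≤ L := by exact_mod_cast i.2
    simp only [c]
    nlinarith
  let g : Fin L → Disk n → ℝ := fun i x => max 0 (r - |‖(x : EuclideanSpace ℝ (Fin n))‖ - c i|)
  have hg : ∀ i x, g i x ≠ 0 → |‖(x : EuclideanSpace ℝ (Fin n))‖ - c i| < r := fun i x h => by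
    by_contra! h1
    exact h (max_eq_left (by linarith))
  have hg1 : ∀ i (x : Disk n), ‖(x : EuclideanSpace ℝ (Fin n))‖ = 1 → g i x = 0 := by
    intro i x hx
    by_contra h
    have h1 := hg i x h
    rw [hx, abs_lt] at h1
    linarith [hc1 i]
  have hgg : ∀ i j x, i ≠ j → g i x * g j x = 0 := by
    intro i j x hij
    by_contra h
    have h1 := abs_lt.1 (hg i x (left_ne_zero_of_mul h))
    have h2 := abs_lt.1 (hg j x (right_ne_zero_of_mul h))
    have h3 : ((i : ℕ) : ℝ) + 1 ≤ j ∨ ((j : ℕ) : ℝ) + 1 ≤ i := by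
      rcases lt_or_gt_of_ne hij with h | h
      · exact .inl (by exact_mod_cast h)
      · exact .inr (by exact_mod_cast h)
    simp only [c] at h1 h2
    rcases h3 with h3 | h3 <;> nlinarith
  choose b hbB hbD using fun i => hA.exists_of_vanishing
    ⟨fun x => (g i x : ℂ) • (1 : Mat k), by simp only [g]; fun_prop⟩
    (fun x hx => by simp [hg1 i x hx])
  have hb : ∀ i x, πD (b i) x = (g i x : ℂ) • (1 : Mat k) := fun i x => by rw [hbD]; rfl
  refine ⟨b, fun i j hij => hA.ext (by simp [hbB]) fun x => ?_, fun i => ?_⟩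
  · rw [map_mul, map_star, ContinuousMap.mul_apply, ContinuousMap.star_apply, hb, hb, map_zero,
      ContinuousMap.zero_apply, star_smul, star_one, smul_mul_smul_comm, Complex.star_def,
      Complex.conj_ofReal, ← Complex.ofReal_mul, hgg i j x hij, Complex.ofReal_zero, zero_smul]
  · let x : Disk n := ⟨EuclideanSpace.single ⟨0, Nat.pos_of_ne_zero hn⟩ (c i), by
      rw [mem_closedBall_zero_iff, PiLp.norm_single, Real.norm_of_nonneg (hc0 i)]
      linarith [hc1 i]⟩
    have hx : ‖(x : EuclideanSpace ℝ (Fin n))‖ = c i := by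
      rw [PiLp.norm_single, Real.norm_of_nonneg (hc0 i)]
    refine ⟨k, (evalHom x).comp πD, fun h => ?_⟩
    have h1 : πD (star (b i) * b i) x = 0 := h
    rw [map_mul, map_star, ContinuousMap.mul_apply, ContinuousMap.star_apply, hb, star_smul,
      star_one, smul_mul_smul_comm, mul_one] at h1
    have h2 := congrFun (congrFun h1 ⟨0, hk⟩) ⟨0, hk⟩
    have h3 : g i x = r := by simp [g, hx, hr.le]
    rw [h3] at h2
    simp [hr.ne'] at h2

theorem IsNCCC.finiteDimensional_or_hasManyOrthogonals {A : Type u} [CStarAlgebra A]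
    (hA : IsNCCC A) : FiniteDimensional ℂ A ∨ HasManyOrthogonals A := by
  induction hA with
  | finiteDimensional A hA => exact .inl hA
  | attachCell A B hB n k hk φ πB πD hA ih =>
    -- For `n = 0` the sphere is empty and `A` is just `B ⊕ M_k`, so both alternatives are inherited
    -- from `B`. For `n ≠ 0` the cell alone gives the second one.
    by_cases hn : n = 0
    · subst hn
      have hsub : ∀ x y : Disk 0, x = y := fun x y => Subtype.ext (Subsingleton.elim _ _)
      have hempty : ∀ x : Disk 0, ‖(x : EuclideanSpace ℝ (Fin 0))‖ ≠ 1 := fun x => by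
        rw [Subsingleton.elim (x : EuclideanSpace ℝ (Fin 0)) 0, norm_zero]
        exact zero_ne_one
      rcases ih with ih | ih
      · left
        let x : Disk 0 := ⟨0, by simp⟩
        let f : A →ₗ[ℂ] B × Mat k := πB.toAlgHom.toLinearMap.prod
          ((evalHom x).comp πD).toAlgHom.toLinearMap
        refine FiniteDimensional.of_injective f fun a a' h => ?_
        refine hA.ext (congrArg Prod.fst h) fun y => ?_
        rw [hsub y x]
        exact congrArg Prod.snd h
      · right
        intro L
        obtain ⟨b, hb, hφ⟩ := ih L
        choose b' hb'B hb'D using fun i => hA.exists_of_boundary (b i) 0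
          (fun x hx => absurd hx (hempty x))
        refine ⟨b', fun i j hij => hA.ext ?_ fun x => ?_, fun i => ?_⟩
        · rw [map_mul, map_star, hb'B, hb'B, hb i j hij, map_zero]
        · rw [map_mul, hb'D, zero_mul, map_zero]
        · obtain ⟨m, ψ, hψ⟩ := hφ i
          refine ⟨m, ψ.comp πB, ?_⟩
          rwa [StarAlgHom.comp_apply, map_mul, map_star, hb'B]
    · exact .inr (HasManyOrthogonals.of_cellPullback hn hA hk)

/-- The ranges of the matrices `φ (star (b i) * b i)` are nonzero and pairwise orthogonal in `ℂ^m`.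
-/
theorem card_le_of_orthogonal {L m : ℕ} {b : Fin L → A}
    (hb : ∀ i j, i ≠ j → b i * star (b j) = 0) (φ : A →⋆ₐ[ℂ] Mat m)
    (hφ : ∀ i, φ (star (b i) * b i) ≠ 0) : L ≤ m := by
  have hex : ∀ i, ∃ v : Fin m → ℂ, φ (star (b i) * b i) *ᵥ v ≠ 0 := fun i => by
    by_contra! h
    apply hφ i
    apply Matrix.ext_of_mulVec_single
    intro j
    rw [h, zero_mulVec]
  choose v hv using hex
  have hlin : LinearIndependent ℂ fun i => WithLp.toLp 2 (φ (star (b i) * b i) *ᵥ v i) := by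
    refine linearIndependent_of_ne_zero_of_inner_eq_zero (𝕜 := ℂ)
      (fun i => by simpa using hv i) fun i j hij => ?_
    change inner ℂ (WithLp.toLp 2 _) (WithLp.toLp 2 _) = 0
    rw [EuclideanSpace.inner_eq_star_dotProduct, dotProduct_comm]
    change star (φ (star (b i) * b i) *ᵥ v i) ⬝ᵥ (φ (star (b j) * b j) *ᵥ v j) = 0
    rw [star_mulVec_dotProduct_mulVec]
    have : star (star (b i) * b i) * (star (b j) * b j) = 0 := by
      rw [star_mul, star_star, mul_assoc, ← mul_assoc (b i), hb i j hij, zero_mul, mul_zero]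
    rw [this, map_zero, zero_mulVec, dotProduct_zero]
  simpa using hlin.fintype_card_le_finrank

end NCCC

/-! ### Traces of representations -/

section RepTraces

open Matrix

variable {A : Type u} [CStarAlgebra A]

theorem normTr_star_mul_self_nonneg (m : ℕ) {r : ℕ} (x : Mat r) : 0 ≤ normTr m (star x * x) := by
  have h := (Matrix.posSemidef_conjTranspose_mul_self x).trace_nonneg
  exact div_nonneg (Complex.le_def.1 h).1 (Nat.cast_nonneg m)

theorem norm_trace_le {r : ℕ} (x : Mat r) : ‖x.trace‖ ≤ r * ‖x‖ := by
  have h : ∀ i, ‖x i i‖ ≤ ‖x‖ := fun i => by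
    have h1 := l2_opNorm_mulVec x (EuclideanSpace.single i 1)
    rw [PiLp.norm_single, norm_one, mul_one] at h1
    refine le_trans ?_ h1
    have h2 := PiLp.norm_apply_le ((EuclideanSpace.equiv (Fin r) ℂ).symm
      (x *ᵥ (EuclideanSpace.single i (1 : ℂ)).ofLp)) i
    simpa using h2
  calc ‖x.trace‖ ≤ ∑ i, ‖x i i‖ := norm_sum_le _ _
    _ ≤ ∑ _i : Fin r, ‖x‖ := Finset.sum_le_sum fun i _ => h i
    _ = r * ‖x‖ := by simp

theorem abs_normTr_le (m : ℕ) {r : ℕ} (x : Mat r) : |normTr m x| ≤ r / m * ‖x‖ := by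
  rw [normTr, abs_div, Nat.abs_cast, div_mul_eq_mul_div]
  exact div_le_div_of_nonneg_right ((Complex.abs_re_le_norm _).trans (norm_trace_le x))
    (Nat.cast_nonneg m)

variable [PartialOrder A] [StarOrderedRing A]

theorem normTr_nonneg (m : ℕ) {r : ℕ} (φ : A →⋆ₐ[ℂ] Mat r) {a : A} (ha : 0 ≤ a) :
    0 ≤ normTr m (φ a) := by
  obtain ⟨b, rfl⟩ := CStarAlgebra.nonneg_iff_eq_star_mul_self.1 ha
  rw [map_mul, map_star]
  exact normTr_star_mul_self_nonneg m _

theorem trace_im_eq_zero {r : ℕ} (φ : A →⋆ₐ[ℂ] Mat r) {a : A} (ha : 0 ≤ a) :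
    (φ a).trace.im = 0 := by
  obtain ⟨b, rfl⟩ := CStarAlgebra.nonneg_iff_eq_star_mul_self.1 ha
  rw [map_mul, map_star]
  exact (Complex.le_def.1 (Matrix.posSemidef_conjTranspose_mul_self (φ b)).trace_nonneg).2.symm

/-- The tracial state of a finite-dimensional representation. -/
theorem exists_tracialState {m : ℕ} (hm : m ≠ 0) (φ : A →⋆ₐ[ℂ] Mat m) :
    ∃ τ : TracialState A, ∀ a, traceHat a τ = normTr m (φ a) := by
  have hm' : (m : ℂ) ≠ 0 := by exact_mod_cast hm
  let f : A →ₗ[ℂ] ℂ := (m : ℂ)⁻¹ • (traceLinearMap (Fin m) ℂ ℂ ∘ₗ φ.toAlgHom.toLinearMap)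
  have hf : ∀ a, f a = (φ a).trace / m := fun a => by
    simp [f, div_eq_inv_mul]
  refine ⟨⟨PositiveLinearMap.mk₀ f fun a ha => ?_, ?_, fun a b => ?_⟩, fun a => ?_⟩
  · obtain ⟨b, rfl⟩ := CStarAlgebra.nonneg_iff_eq_star_mul_self.1 ha
    rw [hf, map_mul, map_star]
    exact div_nonneg (Matrix.posSemidef_conjTranspose_mul_self (φ b)).trace_nonneg
      (Nat.cast_nonneg m)
  · change f 1 = 1
    rw [hf, map_one, trace_one, Fintype.card_fin, div_self hm']
  · change f (a * b) = f (b * a)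
    rw [hf, hf, map_mul, map_mul, trace_mul_comm]
  · change (f a).re = _
    rw [hf, normTr]
    exact Complex.div_natCast_re _ _

/-- The trace of `M_m` is faithful, so the tracial state induced by `φ` detects the element. -/
theorem traceHat_ne_zero {m : ℕ} (φ : A →⋆ₐ[ℂ] Mat m) {b : A} (h : φ (star b * b) ≠ 0) {c : ℝ}
    (hc : c ≠ 0) : traceHat (c • (star b * b)) ≠ 0 := by
  have hm : m ≠ 0 := by
    rintro rfl
    exact h (Subsingleton.elim _ _)
  obtain ⟨τ, hτ⟩ := exists_tracialState hm φ
  intro h0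
  have h1 : normTr m (φ (c • (star b * b))) = 0 := by rw [← hτ, h0]; rfl
  have h2 : φ (c • (star b * b)) = (c : ℂ) • (φ (star b * b)) := by
    rw [← map_smul, Complex.coe_smul]
  rw [h2, normTr, trace_smul, smul_eq_mul, Complex.re_ofReal_mul, div_eq_zero_iff, mul_eq_zero]
    at h1
  have h3 : (φ (star b * b)).trace.re = 0 := (h1.resolve_right (by exact_mod_cast hm)).resolve_left hc
  have h4 : (φ (star b * b)).trace = 0 :=
    Complex.ext h3 (trace_im_eq_zero φ (star_mul_self_nonneg b))
  rw [map_mul, map_star, star_eq_conjTranspose, trace_conjTranspose_mul_self_eq_zero_iff] at h4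
  exact h (by rw [map_mul, h4, mul_zero])

end RepTraces

/-! ### From multiplicities to `K`-fold summands -/

section Multiplicities

open Matrix

variable {A : Type u} [CStarAlgebra A]

theorem IsMultDecomposition.of_frame {K m : ℕ} {Φ : A →⋆ₐ[ℂ] Mat m} {τ σ : FRep A}
    (h : HasDecomp Φ fun o : Option (Fin K) => o.elim τ fun _ => σ) :
    IsMultDecomposition K Φ τ.hom σ.hom := by
  obtain ⟨V, hV, hΦ⟩ := h
  let V₀ : Matrix (Fin m) (Fin τ.dim) ℂ := V none
  let W : Fin K → Matrix (Fin m) (Fin σ.dim) ℂ := fun k => V (some k)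
  have h00 : V₀ᴴ * V₀ = 1 := hV.iso none
  have h0W : ∀ k, V₀ᴴ * W k = 0 := fun k => hV.orth none (some k) (by simp)
  have hW0 : ∀ k, (W k)ᴴ * V₀ = 0 := fun k => hV.orth (some k) none (by simp)
  have hWW : ∀ k, (W k)ᴴ * W k = 1 := fun k => hV.iso (some k)
  have hWW' : ∀ k l, k ≠ l → (W k)ᴴ * W l = 0 := fun k l hkl =>
    hV.orth (some k) (some l) (by simpa using hkl)
  have hsum : V₀ * V₀ᴴ + ∑ k, W k * (W k)ᴴ = 1 := by
    rw [← hV.sum, Fintype.sum_option]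
    rfl
  have hΦ' : ∀ a, Φ a = V₀ * (τ.hom a * V₀ᴴ) + ∑ k, W k * (σ.hom a * (W k)ᴴ) := fun a => by
    rw [hΦ, Fintype.sum_option]; rfl
  let W' : Matrix (Fin m) (Fin σ.dim × Fin K) ℂ := fun x p => W p.2 x p.1
  have hprod : ∀ T : Mat σ.dim,
      W' * blockDiagonal (fun _ : Fin K => T) * W'ᴴ = ∑ k, W k * (T * (W k)ᴴ) := fun T => by
    have h1 : W' * blockDiagonal (fun _ : Fin K => T) =
        of fun x (p : Fin σ.dim × Fin K) => (W p.2 * T) x p.1 := by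
      ext x ⟨y, k⟩
      rw [Matrix.mul_apply, Fintype.sum_prod_type]
      change _ = ∑ z, W k x z * T z y
      refine Finset.sum_congr rfl fun z _ => ?_
      rw [Finset.sum_eq_single k]
      · rw [blockDiagonal_apply, if_pos rfl]
      · intro l _ hl
        rw [blockDiagonal_apply, if_neg hl, mul_zero]
      · simp
    rw [h1]
    ext x y
    simp only [Matrix.sum_apply, ← Matrix.mul_assoc]
    rw [Matrix.mul_apply, Fintype.sum_prod_type_right]
    rfl
  refine ⟨fromCols V₀ W', ?_, ?_, fun a => ?_⟩
  · rw [conjTranspose_fromCols_eq_fromRows_conjTranspose, fromCols_mul_fromRows, ← hsum]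
    have := hprod 1
    simp only [Matrix.one_mul] at this
    rw [← this]
    congr 1
    rw [show (fun _ : Fin K => (1 : Mat σ.dim)) = 1 from rfl, blockDiagonal_one, Matrix.mul_one]
  · rw [conjTranspose_fromCols_eq_fromRows_conjTranspose, fromRows_mul_fromCols, h00,
      ← fromBlocks_one]
    congr 1
    · ext y ⟨z, k⟩
      exact congrFun (congrFun (h0W k) y) z
    · ext ⟨z, k⟩ y
      exact congrFun (congrFun (hW0 k) z) y
    · ext ⟨y, k⟩ ⟨z, l⟩
      change ((W k)ᴴ * W l) y z = _
      by_cases hkl : k = l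
      · subst hkl
        rw [hWW, one_apply, one_apply]
        simp
      · rw [hWW' k l hkl]
        simp [one_apply, hkl]
  · rw [conjTranspose_fromCols_eq_fromRows_conjTranspose, fromCols_mul_fromBlocks,
      fromCols_mul_fromRows, hΦ', ← hprod]
    simp [Matrix.mul_assoc]

/-- Each fibre of `s` is split into `K` blocks of size `M j` and a remainder of size `R j`.
Collecting one block of every type gives a copy of `σ`, and the remainders give `Φ₀`. -/
theorem exists_isMultDecomposition {J I : Type} [Fintype J] [Fintype I] {ρ : J → FRep A} {m : ℕ}
    {Φ : A →⋆ₐ[ℂ] Mat m} {s : I → J} (h : HasDecomp Φ fun i => ρ (s i)) (K : ℕ) (M : J → ℕ)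
    (hM : ∀ j, K * M j ≤ Nat.card {i // s i = j}) {σ : FRep A}
    (hσ : HasDecomp σ.hom fun p : Σ j, Fin (M j) => ρ p.1) :
    ∃ Φ₀ : A →⋆ₐ[ℂ] Mat (m - K * σ.dim), IsMultDecomposition K Φ Φ₀ σ.hom := by
  classical
  choose R hR using fun j => Nat.exists_eq_add_of_le (hM j)
  have e₁ : ∀ j, Nonempty (Fin (R j) ⊕ (Fin K × Fin (M j)) ≃ {i // s i = j}) := fun j => by
    rw [← Fintype.card_eq, Fintype.card_sum, Fintype.card_prod, Fintype.card_fin,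
      Fintype.card_fin, Fintype.card_fin, ← Nat.card_eq_fintype_card, hR j, add_comm]
  let e₁ := fun j => (e₁ j).some
  let N : Option (Fin K) → J → ℕ := fun o => o.elim R fun _ => M
  let e₂ : (Σ o, Σ j, Fin (N o j)) ≃ Σ j, Fin (R j) ⊕ (Fin K × Fin (M j)) :=
    { toFun := fun p => match p with
        | ⟨none, ⟨j, r⟩⟩ => ⟨j, .inl r⟩
        | ⟨some k, ⟨j, r⟩⟩ => ⟨j, .inr (k, r)⟩
      invFun := fun p => match p with
        | ⟨j, .inl r⟩ => ⟨none, ⟨j, r⟩⟩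
        | ⟨j, .inr (k, r)⟩ => ⟨some k, ⟨j, r⟩⟩
      left_inv := by rintro ⟨_ | k, ⟨j, r⟩⟩ <;> rfl
      right_inv := by rintro ⟨j, r | ⟨k, r⟩⟩ <;> rfl }
  let e : (Σ o, Σ j, Fin (N o j)) ≃ I :=
    e₂.trans ((Equiv.sigmaCongrRight e₁).trans (Equiv.sigmaFiberEquiv s))
  have hs : ∀ p, s (e p) = p.2.1 := by
    rintro ⟨_ | k, ⟨j, r⟩⟩
    · exact (e₁ j (.inl r)).2
    · exact (e₁ j (.inr (k, r))).2
  have h₁ := h.reindex e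
  simp only [hs] at h₁
  obtain ⟨τ, hτ⟩ := FRep.exists_sum fun p : Σ j, Fin (R j) => ρ p.1
  have h₂ : HasDecomp Φ fun o : Option (Fin K) => o.elim τ fun _ => σ :=
    HasDecomp.group (J := fun o => Σ j, Fin (N o j)) (σ := fun _ p => ρ p.1) h₁ (by
      rintro (_ | k)
      · exact hτ
      · exact hσ)
  have hdim := h₂.sum_dim
  rw [Fintype.sum_option] at hdim
  simp only [Option.elim_none, Option.elim_some, Finset.sum_const, Finset.card_univ,
    Fintype.card_fin, smul_eq_mul] at hdim
  obtain ⟨d, τ⟩ := τ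
  obtain rfl : d = m - K * σ.dim := by
    simp only at hdim
    omega
  exact ⟨τ, .of_frame h₂⟩

theorem trace_blockDiagonal_const {K r : ℕ} (T : Mat r) :
    (blockDiagonal fun _ : Fin K => T).trace = K * T.trace := by
  rw [trace_blockDiagonal]
  simp

theorem IsMultDecomposition.trace {K m m₀ m₁ : ℕ} {Φ : A →⋆ₐ[ℂ] Mat m} {Φ₀ : A →⋆ₐ[ℂ] Mat m₀}
    {Φ₁ : A →⋆ₐ[ℂ] Mat m₁} (h : IsMultDecomposition K Φ Φ₀ Φ₁) (a : A) :
    (Φ a).trace = (Φ₀ a).trace + K * (Φ₁ a).trace := by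
  obtain ⟨u, -, hu, h⟩ := h
  rw [h, trace_mul_comm, ← Matrix.mul_assoc, hu, Matrix.one_mul,
    ← trace_blockDiagonal_const, Matrix.trace, Fintype.sum_sum_type]
  rfl

end Multiplicities

/-! ### Consequences of the trace hypotheses -/

section TraceEstimates

variable {A : Type u} [CStarAlgebra A]

theorem normTr_map_smul (m : ℕ) {r : ℕ} (φ : A →⋆ₐ[ℂ] Mat r) (c : ℝ) (a : A) :
    normTr m (φ (c • a)) = c * normTr m (φ a) := by
  rw [← Complex.coe_smul, map_smul, normTr, Matrix.trace_smul, smul_eq_mul, Complex.re_ofReal_mul,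
    mul_div_assoc, normTr]

variable [PartialOrder A] [StarOrderedRing A]

theorem IsMultDecomposition.normTr_le {K m m₀ m₁ : ℕ} {Φ : A →⋆ₐ[ℂ] Mat m}
    {Φ₀ : A →⋆ₐ[ℂ] Mat m₀} {Φ₁ : A →⋆ₐ[ℂ] Mat m₁} (h : IsMultDecomposition K Φ Φ₀ Φ₁) {a : A}
    (ha : 0 ≤ a) : normTr m (Φ₀ a) ≤ normTr m (Φ a) := by
  have h₁ := mul_nonneg (Nat.cast_nonneg (α := ℝ) K) (normTr_nonneg m Φ₁ ha)
  have : normTr m (Φ a) = normTr m (Φ₀ a) + K * normTr m (Φ₁ a) := by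
    rw [normTr, normTr, normTr, h.trace, Complex.add_re, ← Complex.ofReal_natCast,
      Complex.re_ofReal_mul]
    ring
  linarith

theorem normTr_eq_zero {a : A} (h : traceHat a = 0) {m : ℕ} (φ : A →⋆ₐ[ℂ] Mat m) :
    normTr m (φ a) = 0 := by
  rcases eq_or_ne m 0 with rfl | hm
  · simp [normTr]
  · obtain ⟨τ, hτ⟩ := exists_tracialState hm φ
    rw [← hτ, h]
    rfl

theorem mul_normTr (m : ℕ) (x : Mat m) : m * normTr m x = x.trace.re := by
  rcases eq_or_ne m 0 with rfl | hm
  · simp [Matrix.trace]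
  · rw [normTr, mul_div_cancel₀]
    exact_mod_cast hm

theorem exists_posUnit_smul {a : A} (ha : 0 ≤ a) (h : traceHat a ≠ 0) :
    ∃ p : PosUnitNeZero A, 0 < ‖a‖ ∧ a = ‖a‖ • p.1 := by
  have h0 : a ≠ 0 := by
    rintro rfl
    apply h
    ext τ
    simp [traceHat]
  have hpos : 0 < ‖a‖ := norm_pos_iff.2 h0
  have hsm : a = ‖a‖ • (‖a‖⁻¹ • a) := by rw [smul_smul, mul_inv_cancel₀ hpos.ne', one_smul]
  refine ⟨⟨‖a‖⁻¹ • a, smul_nonneg (inv_nonneg.2 hpos.le) ha, ?_, fun h1 => h ?_⟩, hpos, hsm⟩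
  · rw [norm_smul, norm_inv, norm_norm, inv_mul_cancel₀ hpos.ne']
  · rw [hsm]
    ext τ
    have h2 := congrFun h1 τ
    simp only [traceHat, Pi.zero_apply] at h2 ⊢
    rw [← Complex.coe_smul, map_smul, smul_eq_mul, Complex.re_ofReal_mul, h2, mul_zero]

/-- Elements of `F` are normalized to norm 1 so that `Δ` applies, and the bound is scaled back by
`‖a‖`. -/
theorem exists_trace_lower_bound (Δ : AffPosUnitNeZero A → Set.Ioo (0 : ℝ) 1) (F : Finset A) :
    ∃ c > 0, ∃ H : Finset (PosUnitNeZero A), ∀ (m : ℕ) (φ : A →⋆ₐ[ℂ] Mat m),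
      (∀ h ∈ H, (Δ h.hat : ℝ) < normTr m (φ h.1)) →
      ∀ a ∈ F, 0 ≤ a → traceHat a ≠ 0 → c ≤ normTr m (φ a) := by
  classical
  induction F using Finset.induction_on with
  | empty => exact ⟨1, one_pos, ∅, by simp⟩
  | insert a F _ ih =>
    obtain ⟨c, hc, H, hH⟩ := ih
    by_cases ha : 0 ≤ a ∧ traceHat a ≠ 0
    · obtain ⟨p, hpos, hp⟩ := exists_posUnit_smul ha.1 ha.2
      refine ⟨min c (‖a‖ * Δ p.hat), lt_min hc (mul_pos hpos (Δ p.hat).2.1), insert p H,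
        fun m φ h b hb hb0 hb1 => ?_⟩
      rcases Finset.mem_insert.1 hb with rfl | hb
      · refine (min_le_right _ _).trans ?_
        conv_rhs => rw [hp]
        rw [normTr_map_smul]
        exact mul_le_mul_of_nonneg_left (h p (by simp)).le hpos.le
      · exact (min_le_left _ _).trans
          (hH m φ (fun q hq => h q (Finset.mem_insert_of_mem hq)) b hb hb0 hb1)
    · refine ⟨c, hc, H, fun m φ h b hb hb0 hb1 => ?_⟩
      rcases Finset.mem_insert.1 hb with rfl | hb
      · exact absurd ⟨hb0, hb1⟩ ha
      · exact hH m φ h b hb hb0 hb1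

/-- A trace above the positive value of `Δ` keeps each of `L` orthogonal elements nonzero under `φ`,
which needs `L` dimensions. -/
theorem HasManyOrthogonals.exists_le_dim (hA : HasManyOrthogonals A)
    (Δ : AffPosUnitNeZero A → Set.Ioo (0 : ℝ) 1) (L : ℕ) :
    ∃ H : Finset (PosUnitNeZero A), ∀ (m : ℕ) (φ : A →⋆ₐ[ℂ] Mat m),
      (∀ h ∈ H, (Δ h.hat : ℝ) < normTr m (φ h.1)) → L ≤ m := by
  classical
  obtain ⟨b, hb, hφ⟩ := hA L
  have hp : ∀ i, ∃ p : PosUnitNeZero A, ∃ c : ℝ, star (b i) * b i = c • p.1 ∧ c ≠ 0 := fun i => by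
    obtain ⟨m, φ, h⟩ := hφ i
    have h1 := traceHat_ne_zero φ h one_ne_zero
    rw [one_smul] at h1
    obtain ⟨p, h2, h3⟩ := exists_posUnit_smul (star_mul_self_nonneg (b i)) h1
    exact ⟨p, _, h3, h2.ne'⟩
  choose p c hpc hc using hp
  refine ⟨Finset.univ.image p, fun m φ h => card_le_of_orthogonal hb φ fun i h0 => ?_⟩
  have h1 := (Δ (p i).hat).2.1.trans (h (p i) (Finset.mem_image_of_mem _ (Finset.mem_univ _)))
  have h2 := normTr_map_smul m φ (c i) (p i).1
  rw [← hpc, h0] at h2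
  have h3 : normTr m (0 : Mat m) = 0 := by simp [normTr]
  rw [h3] at h2
  exact mul_ne_zero (hc i) h1.ne' h2.symm

/-- The test elements from `FinitelyTyped` need not be positive. As positive elements span `A`,
control on finitely many of them suffices. -/
theorem exists_trace_control (x : A) : ∀ κ > (0 : ℝ), ∃ (H : Finset A) (δ : ℝ), (∀ h ∈ H, 0 ≤ h) ∧
    0 < δ ∧ ∀ (m : ℕ) (φ ψ : A →⋆ₐ[ℂ] Mat m),
      (∀ h ∈ H, |normTr m (φ h) - normTr m (ψ h)| < δ) →
      ‖(φ x).trace - (ψ x).trace‖ ≤ κ * m := by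
  classical
  have hx : x ∈ Submodule.span ℂ {a : A | 0 ≤ a} := by
    rw [CStarAlgebra.span_nonneg]
    trivial
  induction hx using Submodule.span_induction with
  | mem x hx =>
    intro κ hκ
    refine ⟨{x}, κ, by simpa using hx, hκ, fun m φ ψ h => ?_⟩
    have h1 := h x (by simp)
    have h2 : (φ x).trace - (ψ x).trace = ((m * (normTr m (φ x) - normTr m (ψ x)) : ℝ) : ℂ) := by
      rw [mul_sub, mul_normTr, mul_normTr]
      apply Complex.ext
      · simp
      · simp [trace_im_eq_zero φ hx, trace_im_eq_zero ψ hx]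
    rw [h2, Complex.norm_real, Real.norm_eq_abs, abs_mul, Nat.abs_cast, mul_comm]
    exact mul_le_mul_of_nonneg_right h1.le (Nat.cast_nonneg m)
  | zero =>
    intro κ hκ
    refine ⟨∅, 1, by simp, one_pos, fun m φ ψ _ => ?_⟩
    simpa using mul_nonneg hκ.le (Nat.cast_nonneg m)
  | add x y _ _ ihx ihy =>
    intro κ hκ
    obtain ⟨H, δ, hH, hδ, h⟩ := ihx (κ / 2) (half_pos hκ)
    obtain ⟨H', δ', hH', hδ', h'⟩ := ihy (κ / 2) (half_pos hκ)
    refine ⟨H ∪ H', min δ δ', fun a ha => (Finset.mem_union.1 ha).elim (hH a) (hH' a),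
      lt_min hδ hδ', fun m φ ψ hc => ?_⟩
    have h1 := h m φ ψ fun a ha =>
      (hc a (Finset.mem_union_left _ ha)).trans_le (min_le_left _ _)
    have h2 := h' m φ ψ fun a ha =>
      (hc a (Finset.mem_union_right _ ha)).trans_le (min_le_right _ _)
    rw [map_add, map_add, Matrix.trace_add, Matrix.trace_add, add_sub_add_comm]
    refine (norm_add_le _ _).trans ?_
    linarith
  | smul c x _ ih =>
    intro κ hκ
    have hc : 0 < ‖c‖ + 1 := by positivity
    obtain ⟨H, δ, hH, hδ, h⟩ := ih (κ / (‖c‖ + 1)) (div_pos hκ hc)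
    refine ⟨H, δ, hH, hδ, fun m φ ψ hcl => ?_⟩
    have h1 := h m φ ψ hcl
    rw [map_smul, map_smul, Matrix.trace_smul, Matrix.trace_smul, ← smul_sub, norm_smul]
    calc ‖c‖ * ‖(φ x).trace - (ψ x).trace‖ ≤ (‖c‖ + 1) * (κ / (‖c‖ + 1) * m) :=
          mul_le_mul (by linarith) h1 (norm_nonneg _) hc.le
      _ = κ * m := by field_simp

theorem exists_trace_control_fintype {J : Type} [Fintype J] (x : J → A) {κ : ℝ} (hκ : 0 < κ) :
    ∃ (H : Finset A) (δ : ℝ), (∀ h ∈ H, 0 ≤ h) ∧ 0 < δ ∧ ∀ (m : ℕ) (φ ψ : A →⋆ₐ[ℂ] Mat m),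
      (∀ h ∈ H, |normTr m (φ h) - normTr m (ψ h)| < δ) →
      ∀ j, ‖(φ (x j)).trace - (ψ (x j)).trace‖ ≤ κ * m := by
  classical
  choose H δ hH hδ h using fun j => exists_trace_control (x j) κ hκ
  obtain ⟨δ₀, hδ₀, hle⟩ : ∃ δ₀ > 0, ∀ j, δ₀ ≤ δ j := by
    rcases isEmpty_or_nonempty J with hJ | hJ
    · exact ⟨1, one_pos, fun j => hJ.elim j⟩
    · obtain ⟨j, hj⟩ := Finite.exists_min δ
      exact ⟨δ j, hδ j, hj⟩
  refine ⟨Finset.univ.biUnion H, δ₀, fun a ha => ?_, hδ₀, fun m φ ψ hc j => ?_⟩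
  · obtain ⟨j, -, hj⟩ := Finset.mem_biUnion.1 ha
    exact hH j a hj
  · exact h j m φ ψ fun a ha =>
      (hc a (Finset.mem_biUnion.2 ⟨j, Finset.mem_univ _, ha⟩)).trans_le (hle j)

end TraceEstimates

/-! ### Common summands and the main theorem -/

section MainTheorem

open Matrix

variable {A : Type u} [CStarAlgebra A]

theorem HasDecomp.dim_eq_sum_card {J I : Type} [Fintype J] [Fintype I] {ρ : J → FRep A} {m : ℕ}
    {Φ : A →⋆ₐ[ℂ] Mat m} {s : I → J} (h : HasDecomp Φ fun i => ρ (s i)) :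
    (m : ℝ) = ∑ j, (ρ j).dim * (Nat.card {i // s i = j} : ℝ) := by
  classical
  rw [← h.sum_dim, Nat.cast_sum]
  have h1 : ∀ j, (Nat.card {i // s i = j} : ℝ) = ∑ i, if s i = j then 1 else 0 := natCard_fiber s
  simp only [h1, Finset.mul_sum]
  rw [Finset.sum_comm]
  refine Finset.sum_congr rfl fun i _ => ?_
  rw [Finset.sum_eq_single (s i)]
  · simp
  · intro j _ hj
    simp [hj.symm]
  · simp

/-- Two direct sums of the same representations with nearly equal multiplicities share a summand
of multiplicity `K` with a small complement. -/
theorem exists_common_multiple {J I I' : Type} [Fintype J] [Fintype I] [Fintype I']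
    {ρ : J → FRep A} {m : ℕ} {Φ Ψ : A →⋆ₐ[ℂ] Mat m} {s : I → J} {s' : I' → J}
    (hΦ : HasDecomp Φ fun i => ρ (s i)) (hΨ : HasDecomp Ψ fun i => ρ (s' i)) {K : ℕ} (hK : K ≠ 0) :
    ∃ (m₀ m₁ : ℕ) (Φ₀ Ψ₀ : A →⋆ₐ[ℂ] Mat m₀) (Φ₁ : A →⋆ₐ[ℂ] Mat m₁),
      IsMultDecomposition K Φ Φ₀ Φ₁ ∧ IsMultDecomposition K Ψ Ψ₀ Φ₁ ∧
      (m₀ : ℝ) ≤ ∑ j, (ρ j).dim *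
        (‖(Nat.card {i // s i = j} : ℂ) - (Nat.card {i // s' i = j} : ℂ)‖ + K) := by
  let N : J → ℕ := fun j => Nat.card {i // s i = j}
  let N' : J → ℕ := fun j => Nat.card {i // s' i = j}
  let M : J → ℕ := fun j => min (N j) (N' j) / K
  have hM : ∀ j, K * M j ≤ min (N j) (N' j) := fun j => Nat.mul_div_le _ _
  obtain ⟨σ, hσ⟩ := FRep.exists_sum fun p : Σ j, Fin (M j) => ρ p.1
  obtain ⟨Φ₀, h⟩ := exists_isMultDecomposition hΦ K M
    (fun j => (hM j).trans (min_le_left _ _)) hσ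
  obtain ⟨Ψ₀, h'⟩ := exists_isMultDecomposition hΨ K M
    (fun j => (hM j).trans (min_le_right _ _)) hσ
  refine ⟨_, _, Φ₀, Ψ₀, σ.hom, h, h', ?_⟩
  have hσdim : (σ.dim : ℝ) = ∑ j, (ρ j).dim * (M j : ℝ) := by
    rw [← hσ.sum_dim, Fintype.sum_sigma]
    push_cast
    refine Finset.sum_congr rfl fun j _ => ?_
    simp [mul_comm]
  have hnonneg : 0 ≤ ∑ j, (ρ j).dim * (‖(N j : ℂ) - (N' j : ℂ)‖ + K) :=
    Finset.sum_nonneg fun j _ => by positivity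
  rcases le_total m (K * σ.dim) with hle | hle
  · rw [Nat.sub_eq_zero_of_le hle, Nat.cast_zero]
    exact hnonneg
  rw [Nat.cast_sub hle, Nat.cast_mul, hΦ.dim_eq_sum_card, hσdim, Finset.mul_sum,
    ← Finset.sum_sub_distrib]
  refine Finset.sum_le_sum fun j _ => ?_
  rw [mul_left_comm, ← mul_sub]
  refine mul_le_mul_of_nonneg_left ?_ (Nat.cast_nonneg _)
  -- Rounding down to a multiple of `K` loses fewer than `K` copies of each type; passing to the
  -- minimum loses at most the difference of the multiplicities.
  have h1 : min (N j) (N' j) < K * M j + K := by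
    have := Nat.lt_mul_div_succ (min (N j) (N' j)) (Nat.pos_of_ne_zero hK)
    rwa [mul_add, mul_one] at this
  have h2 : (min (N j : ℝ) (N' j)) < K * M j + K := by exact_mod_cast h1
  have h3 : ‖(N j : ℂ) - (N' j : ℂ)‖ = |(N j : ℝ) - N' j| := by
    rw [← Real.norm_eq_abs, ← Complex.norm_real]
    push_cast
    rfl
  rw [h3]
  change (N j : ℝ) - K * M j ≤ _
  rcases min_choice (N j : ℝ) (N' j) with h4 | h4 <;> rw [h4] at h2
  · linarith [abs_nonneg ((N j : ℝ) - N' j)]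
  · linarith [le_abs_self ((N j : ℝ) - N' j)]

theorem norm_sub_le_add_add {E : Type*} [SeminormedAddCommGroup E] (a b x y : E) :
    ‖a - b‖ ≤ ‖a - x‖ + ‖x - y‖ + ‖b - y‖ := by
  have h := (norm_sub_le (a - x + (x - y)) (b - y)).trans
    (add_le_add_left (norm_add_le (a - x) (x - y)) _)
  have h2 : a - x + (x - y) - (b - y) = a - b := by abel
  rwa [h2] at h

variable [PartialOrder A] [StarOrderedRing A]

theorem FinitelyTyped.exists_common_summand (hA : FinitelyTyped A) (hA' : HasManyOrthogonals A)
    (Δ : AffPosUnitNeZero A → Set.Ioo (0 : ℝ) 1) (F : Finset A) {ε θ : ℝ} (hε : 0 < ε)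
    (hθ : 0 < θ) {K : ℕ} (hK : K ≠ 0) :
    ∃ (H₁ : Finset (PosUnitNeZero A)) (H₂ : Finset A) (δ : ℝ),
      (∀ h ∈ H₂, 0 ≤ h) ∧ 0 < δ ∧
      ∀ (m : ℕ) (φ ψ : A →⋆ₐ[ℂ] Mat m),
        (∀ h ∈ H₁, (Δ h.hat : ℝ) < normTr m (φ h.1)) →
        (∀ h ∈ H₂, |normTr m (φ h) - normTr m (ψ h)| < δ) →
        0 < m ∧ ∃ (φ' ψ' : A →⋆ₐ[ℂ] Mat m) (m₀ m₁ : ℕ)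
          (φ₀ ψ₀ : A →⋆ₐ[ℂ] Mat m₀) (φ₁ : A →⋆ₐ[ℂ] Mat m₁),
          (∀ f ∈ F, ‖φ' f - φ f‖ ≤ ε ∧ ‖ψ' f - ψ f‖ ≤ ε) ∧
          IsMultDecomposition K φ' φ₀ φ₁ ∧ IsMultDecomposition K ψ' ψ₀ φ₁ ∧
          (m₀ : ℝ) ≤ θ * m := by
  -- The four quarters of `θ` pay for the multiplicity errors of `φ` and of `ψ`, for the difference
  -- of their traces, and for the constants `2 * C + K * D`.
  obtain ⟨J, _, ρ, x, C, hC, h⟩ := hA F F.finite_toSet ε hε (θ / 4) (by positivity)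
  let D : ℝ := ∑ j, ((ρ j).dim : ℝ)
  have hD : 0 ≤ D := Finset.sum_nonneg fun j _ => Nat.cast_nonneg _
  obtain ⟨H₂, δ, hH₂, hδ, hcontrol⟩ := exists_trace_control_fintype x
    (κ := θ / (4 * (D + 1))) (by positivity)
  -- Dimension at least `L` absorbs the additive constants; the summand 1 also excludes `m = 0`.
  obtain ⟨L, hL⟩ := exists_nat_ge ((2 * C + K * D) / (θ / 4) + 1)
  obtain ⟨H₁, hH₁⟩ := hA'.exists_le_dim Δ L
  refine ⟨H₁, H₂, δ, hH₂, hδ, fun m φ ψ h1 h2 => ?_⟩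
  have hLm : (2 * C + K * D) / (θ / 4) + 1 ≤ (m : ℝ) :=
    hL.trans (by exact_mod_cast hH₁ m φ h1)
  have hm : 0 < (m : ℝ) := by
    have : 0 ≤ (2 * C + K * D) / (θ / 4) := by positivity
    linarith
  have hCm : 2 * C + K * D ≤ θ / 4 * m := by
    rw [← div_le_iff₀' (by positivity)]
    linarith
  obtain ⟨φ', I, _, s, hφ, hφF, hφC⟩ := h m φ
  obtain ⟨ψ', I', _, s', hψ, hψF, hψC⟩ := h m ψ
  obtain ⟨m₀, m₁, φ₀, ψ₀, φ₁, hφ₀, hψ₀, hm₀⟩ := exists_common_multiple hφ hψ hK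
  refine ⟨by exact_mod_cast hm, φ', ψ', m₀, m₁, φ₀, ψ₀, φ₁,
    fun f hf => ⟨hφF f hf, hψF f hf⟩, hφ₀, hψ₀, hm₀.trans ?_⟩
  have htr : ∑ j, (ρ j).dim * ‖(φ (x j)).trace - (ψ (x j)).trace‖ ≤ θ / 4 * m := by
    calc _ ≤ ∑ j, ((ρ j).dim : ℝ) * (θ / (4 * (D + 1)) * m) := Finset.sum_le_sum fun j _ =>
          mul_le_mul_of_nonneg_left (hcontrol m φ ψ h2 j) (Nat.cast_nonneg _)
      _ = D * (θ / (4 * (D + 1)) * m) := (Finset.sum_mul _ _ _).symm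
      _ ≤ (D + 1) * (θ / (4 * (D + 1)) * m) :=
          mul_le_mul_of_nonneg_right (by linarith) (by positivity)
      _ = θ / 4 * m := by field_simp
  calc _ ≤ ∑ j, ((ρ j).dim : ℝ) * (‖(Nat.card {i // s i = j} : ℂ) - (φ (x j)).trace‖ +
          ‖(φ (x j)).trace - (ψ (x j)).trace‖ +
          ‖(Nat.card {i // s' i = j} : ℂ) - (ψ (x j)).trace‖ + K) :=
        Finset.sum_le_sum fun j _ => mul_le_mul_of_nonneg_left
          (add_le_add_left (norm_sub_le_add_add _ _ _ _) _) (Nat.cast_nonneg _)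
    _ = ∑ j, (ρ j).dim * ‖(Nat.card {i // s i = j} : ℂ) - (φ (x j)).trace‖ +
        ∑ j, (ρ j).dim * ‖(φ (x j)).trace - (ψ (x j)).trace‖ +
        ∑ j, (ρ j).dim * ‖(Nat.card {i // s' i = j} : ℂ) - (ψ (x j)).trace‖ + K * D := by
      simp only [mul_add, Finset.sum_add_distrib, ← Finset.sum_mul, D, mul_comm (K : ℝ)]
    _ ≤ θ * m := by linarith

/-- If all traces vanish on `a`, both sides are 0. Otherwise the perturbation keeps at least half of
the lower bound `c`, while a block of relative dimension `θ` has trace at most `θ * ‖a‖`. -/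
theorem normTr_small_summand_le {K m m₀ m₁ : ℕ} {Φ Φ' : A →⋆ₐ[ℂ] Mat m} {Φ₀ : A →⋆ₐ[ℂ] Mat m₀}
    {Φ₁ : A →⋆ₐ[ℂ] Mat m₁} (h : IsMultDecomposition K Φ' Φ₀ Φ₁) (hm : 0 < m) {a : A}
    (ha : 0 ≤ a) {c η θ : ℝ} (hη : 0 < η) (hc : traceHat a ≠ 0 → c ≤ normTr m (Φ a))
    (hclose : ‖Φ' a - Φ a‖ ≤ c / 2) (hm₀ : (m₀ : ℝ) ≤ θ * m) (hθ : θ * ‖a‖ ≤ η * (c / 2)) :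
    normTr m (Φ₀ a) ≤ η * normTr m (Φ' a) := by
  by_cases h0 : traceHat a = 0
  · have h1 := h.normTr_le ha
    rw [normTr_eq_zero h0] at h1 ⊢
    rwa [mul_zero]
  have hm' : (0 : ℝ) < m := by exact_mod_cast hm
  have h1 := abs_normTr_le m (Φ' a - Φ a)
  rw [div_self hm'.ne', one_mul] at h1
  have h2 : normTr m (Φ' a - Φ a) = normTr m (Φ' a) - normTr m (Φ a) := by
    rw [normTr, trace_sub, Complex.sub_re, sub_div, normTr, normTr]
  have h3 : c / 2 ≤ normTr m (Φ' a) := by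
    have := (abs_le.1 (h1.trans hclose)).1
    linarith [hc h0]
  have h4 : (m₀ : ℝ) / m ≤ θ := (div_le_iff₀ hm').2 hm₀
  calc normTr m (Φ₀ a) ≤ m₀ / m * ‖Φ₀ a‖ := (le_abs_self _).trans (abs_normTr_le m _)
    _ ≤ m₀ / m * ‖a‖ := mul_le_mul_of_nonneg_left (NonUnitalStarAlgHom.norm_apply_le Φ₀ a)
        (by positivity)
    _ ≤ θ * ‖a‖ := mul_le_mul_of_nonneg_right h4 (norm_nonneg a)
    _ ≤ η * (c / 2) := hθ
    _ ≤ η * normTr m (Φ' a) := mul_le_mul_of_nonneg_left h3 hη.le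

end MainTheorem

theorem mainTheorem5 {A B : Type u} [CStarAlgebra A] [PartialOrder A] [StarOrderedRing A]
    [CStarAlgebra B] (hB : IsNCCC B) {n k : ℕ} (hk : 0 < k)
    (φglue : B →⋆ₐ[ℂ] C(DiskBoundary n, Mat k))
    (πB : A →⋆ₐ[ℂ] B) (πD : A →⋆ₐ[ℂ] C(Disk n, Mat k))
    (hA : IsCellPullback φglue πB πD) (hinf : ¬ FiniteDimensional ℂ A)
    (Δ : AffPosUnitNeZero A → Set.Ioo (0 : ℝ) 1) (hΔ : Monotone Δ)
    (F : Finset A) (ε η : ℝ) (hε : 0 < ε) (hη : 0 < η) (K : ℕ) (hK : K ≠ 0) :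
    ∃ (H₁ : Finset (PosUnitNeZero A)) (H₂ : Finset A) (δ : ℝ),
      (∀ h ∈ H₂, 0 ≤ h) ∧ 0 < δ ∧
      ∀ (m : ℕ) (φ ψ : A →⋆ₐ[ℂ] Mat m),
        (∀ h ∈ H₁, (Δ h.hat : ℝ) < normTr m (φ h.1) ∧ (Δ h.hat : ℝ) < normTr m (ψ h.1)) →
        (∀ h ∈ H₂, |normTr m (φ h) - normTr m (ψ h)| < δ) →
        ∃ (φ' ψ' : A →⋆ₐ[ℂ] Mat m) (m₀ m₁ : ℕ)
          (φ₀ ψ₀ : A →⋆ₐ[ℂ] Mat m₀) (φ₁ ψ₁ : A →⋆ₐ[ℂ] Mat m₁),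
          (∀ f ∈ F, ‖φ' f - φ f‖ < ε ∧ ‖ψ' f - ψ f‖ < ε) ∧
          IsMultDecomposition K φ' φ₀ φ₁ ∧ IsMultDecomposition K ψ' ψ₀ ψ₁ ∧
          UnitarilyEquivalent φ₁ ψ₁ ∧
          ∀ a ∈ F, 0 ≤ a →
            normTr m (φ₀ a) ≤ η * normTr m (φ' a) ∧
            normTr m (ψ₀ a) ≤ η * normTr m (ψ' a) := by
  classical
  have hN : IsNCCC A := .attachCell A B hB n k hk φglue πB πD hA
  have hMany := hN.finiteDimensional_or_hasManyOrthogonals.resolve_left hinf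
  obtain ⟨c, hc, H, hH⟩ := exists_trace_lower_bound Δ F
  let R : ℝ := 1 + ∑ a ∈ F, ‖a‖
  have hR : 0 < R := by
    have : 0 ≤ ∑ a ∈ F, ‖a‖ := Finset.sum_nonneg fun a _ => norm_nonneg a
    linarith
  have hRa : ∀ a ∈ F, ‖a‖ ≤ R := fun a ha => by
    have := Finset.single_le_sum (f := fun a => ‖a‖) (fun a _ => norm_nonneg a) ha
    linarith
  obtain ⟨H₁, H₂, δ, hH₂, hδ, h⟩ := hN.finitelyTyped.exists_common_summand hMany Δ F
    -- `ε / 2` makes the final estimate strict, `c / 2` protects the trace lower bound, and `R`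
    -- dominates the norms on `F`, so `θ * ‖a‖ ≤ η * (c / 2)`.
    (ε := min (ε / 2) (c / 2)) (θ := η * (c / 2) / R) (by positivity) (by positivity) hK
  refine ⟨H ∪ H₁, H₂, δ, hH₂, hδ, fun m φ ψ h1 h2 => ?_⟩
  obtain ⟨hm, φ', ψ', m₀, m₁, φ₀, ψ₀, φ₁, hclose, hφ, hψ, hm₀⟩ :=
    h m φ ψ (fun p hp => (h1 p (Finset.mem_union_right _ hp)).1) h2
  have hθ : ∀ a ∈ F, η * (c / 2) / R * ‖a‖ ≤ η * (c / 2) := fun a ha => by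
    rw [div_mul_eq_mul_div, div_le_iff₀ hR]
    exact mul_le_mul_of_nonneg_left (hRa a ha) (by positivity)
  -- Both decompositions use the same homomorphism `φ₁`, so the unitary equivalence is the identity.
  refine ⟨φ', ψ', m₀, m₁, φ₀, ψ₀, φ₁, φ₁, fun f hf => ?_, hφ, hψ,
    ⟨1, one_mem _, fun a => by simp⟩, fun a ha ha0 => ⟨?_, ?_⟩⟩
  · have h3 := hclose f hf
    have h4 : min (ε / 2) (c / 2) < ε := (min_le_left _ _).trans_lt (half_lt_self hε)
    exact ⟨h3.1.trans_lt h4, h3.2.trans_lt h4⟩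
  · exact normTr_small_summand_le hφ hm ha0 hη
      (hH m φ (fun p hp => (h1 p (Finset.mem_union_left _ hp)).1) a ha ha0)
      ((hclose a ha).1.trans (min_le_right _ _)) hm₀ (hθ a ha)
  · exact normTr_small_summand_le hψ hm ha0 hη
      (hH m ψ (fun p hp => (h1 p (Finset.mem_union_left _ hp)).2) a ha ha0)
      ((hclose a ha).2.trans (min_le_right _ _)) hm₀ (hθ a ha)
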